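/- Let $\bar S_2$ be the complex Lie algebra of all derivations $p_1\partial_1+p_2\partial_2$ of $\mathbb{C}[t_1,t_2]$ (where $\partial_i=\partial/\partial t_i$) whose divergence $\partial_1(p_1)+\partial_2(p_2)$ is constant. It contains $\partial_1,\partial_2$, the elements $d_i=t_i\partial_i$, and, for every $\alpha=(\alpha_1,\alpha_2)\in\mathbb{Z}^2_{\ge -1}$, the element $$L_\alpha=(1+\alpha_2)\,t^{\alpha+e_1}\partial_1-(1+\alpha_1)\,t^{\alpha+e_2}\partial_2 ,$$ where a term with coefficient $0$ is read as $0$. Let $U_{(-1)}$ be the localization of the universal enveloping algebra $U(\bar S_2)$ at the Ore set $\{\partial_1^{i}\partial_2^{j}\mid i,j\ge 0\}$, and let $$H=\{u\in U_{(-1)}\mid [u,\partial_i]=[u,d_i]=0,\ i=1,2\},$$ a subalgebra of $U_{(-1)}$. Write $|\alpha|=\alpha_1+\alpha_2$, $\partial^\alpha=\partial_1^{\alpha_1}\partial_2^{\alpha_2}$ and $\binom{\alpha+\mathbf 1}{\beta+\mathbf 1}=\binom{\alpha_1+1}{\beta_1+1}\binom{\alpha_2+1}{\beta_2+1}$. For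 $\alpha\in\mathbb{Z}^2_{\ge -1}$ with $|\alpha|\ge 0$ and $\alpha\ne \mathbf 0$ define the following element of $U_{(-1)}$, in which empty products are $1$ and $\beta$ runs over $\mathbb{Z}^2_{\ge -1}$: $$\begin{aligned}Y_\alpha={}&L_\alpha\partial^\alpha+\sum_{0\le|\beta|<|\alpha|,\ \beta\ne\mathbf 0}(-1)^{|\alpha|-|\beta|}\binom{\alpha+\mathbf 1}{\beta+\mathbf 1}L_\beta\prod_{m_1=0}^{\alpha_1-\beta_1-1}(d_1-m_1)\prod_{m_2=0}^{\alpha_2-\beta_2-1}(d_2-m_2)\,\partial^\beta\\&+(-1)^{|\alpha|}\alpha_1(\alpha_2+1)\prod_{i=-1}^{\alpha_1-1}(d_1-i)\prod_{j=0}^{\alpha_2-1}(d_2-j)\\&+(-1)^{|\alpha|-1}(\alpha_1+1)\alpha_2\prod_{i=0}^{\alpha_1-1}(d_1-i)\prod_{j=-1}^{\alpha_2-1}(d_2-j).\end{aligned}$$ Fix any total order on the set of all such $\alpha$. Then the ordered monomials $Y_{\alpha^{(1)}}Y_{\alpha^{(2)}}\cdots Y_{\alpha^{(k)}}$ with $k\ge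 0$ and $\alpha^{(1)}\le\alpha^{(2)}\le\cdots\le\alpha^{(k)}$ lie in $H$ and form a basis of $H$ over $\mathbb{C}$. Moreover, the algebra $H$ is generated by $Y_{(1,-1)}$, $Y_{(-1,1)}$, $Y_{(1,0)}$ and $Y_{(0,1)}$. -/

import Mathlib

noncomputable section

namespace SBarTwo

open MvPolynomial

/-- The polynomial algebra `A₂ = ℂ[t₁, t₂]`; the variable `t₁` is `X 0`, the variable `t₂` is
`X 1`. -/
abbrev A2 : Type := MvPolynomial (Fin 2) ℂ

/-- The Witt algebra `W₂` of derivations of `A₂`. -/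
abbrev W2 : Type := Derivation ℂ A2 A2

/-- The divergence of `p₁ ∂₁ + p₂ ∂₂`, namely `∂₁ p₁ + ∂₂ p₂`; here `pᵢ = D tᵢ`. -/
def divergence (D : W2) : A2 := ∑ i : Fin 2, pderiv i (D (X i))

theorem derivation_apply (D : W2) (f : A2) :
    D f = D (X 0) * pderiv 0 f + D (X 1) * pderiv 1 f := by
  have h : D = D (X 0) • (pderiv 0 : W2) + D (X 1) • (pderiv 1 : W2) := by
    apply MvPolynomial.derivation_ext
    intro i
    fin_cases i <;> simp [pderiv_X]
  conv_lhs => rw [h]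
  simp

theorem pderiv_comm (i j : Fin 2) (f : A2) :
    pderiv i (pderiv j f) = pderiv j (pderiv i f) := by
  have h : ⁅(pderiv i : W2), (pderiv j : W2)⁆ = 0 := by
    apply MvPolynomial.derivation_ext
    intro k
    rw [Derivation.commutator_apply]
    simp only [pderiv_X, Pi.single_apply]
    split_ifs <;> simp
  have h' := congrArg (fun D : W2 => D f) h
  simp only [Derivation.commutator_apply, Derivation.zero_apply] at h'
  exact sub_eq_zero.mp h'

theorem divergence_lie (D E : W2) :
    divergence ⁅D, E⁆ = D (divergence E) - E (divergence D) := by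
  simp only [divergence, Fin.sum_univ_two, Derivation.commutator_apply]
  rw [derivation_apply D (E (X 0)), derivation_apply D (E (X 1)),
    derivation_apply E (D (X 0)), derivation_apply E (D (X 1)),
    derivation_apply D (_ + _), derivation_apply E (_ + _)]
  simp only [map_add, map_sub, Derivation.leibniz, smul_eq_mul]
  rw [pderiv_comm 1 0 (E (X 0)), pderiv_comm 1 0 (D (X 0)),
    pderiv_comm 1 0 (E (X 1)), pderiv_comm 1 0 (D (X 1))]
  ring

/-- The Lie algebra `S̄₂` of all derivations of `A₂` whose divergence is constant. -/
def SBar : LieSubalgebra ℂ W2 where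
  carrier := {D | ∃ c : ℂ, divergence D = C c}
  add_mem' := by
    rintro D E ⟨c, hc⟩ ⟨e, he⟩
    refine ⟨c + e, ?_⟩
    rw [map_add, ← hc, ← he]
    simp only [divergence, Derivation.add_apply, map_add, Finset.sum_add_distrib]
  zero_mem' := ⟨0, by simp [divergence]⟩
  smul_mem' := by
    rintro a D ⟨c, hc⟩
    refine ⟨a * c, ?_⟩
    rw [map_mul, ← hc]
    simp [divergence, MvPolynomial.smul_eq_C_mul, mul_add]
  lie_mem' := by
    rintro D E ⟨c, hc⟩ ⟨e, he⟩
    have hc' : divergence D = C c := hc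
    have he' : divergence E = C e := he
    refine ⟨0, ?_⟩
    rw [divergence_lie, hc', he', MvPolynomial.derivation_C, MvPolynomial.derivation_C]
    simp

/-- `∂ᵢ` as an element of `S̄₂`. -/
def partialS (i : Fin 2) : SBar :=
  ⟨pderiv i, 0, by
    simp only [divergence, pderiv_X, Pi.single_apply, Fin.sum_univ_two]
    split_ifs <;> simp⟩

/-- `dᵢ = tᵢ ∂ᵢ` as an element of `S̄₂`. -/
def eulerS (i : Fin 2) : SBar :=
  ⟨(X i : A2) • (pderiv i : W2), 1, by
    fin_cases i <;> simp [divergence, pderiv_X]⟩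

/-- The derivation `(1 + α₂) t^{α + e₁} ∂₁ - (1 + α₁) t^{α + e₂} ∂₂`, meant for `α₁, α₂ ≥ -1`. For
such `α` an exponent can only be negative where the coefficient in front of it vanishes. -/
def derivationL (α : ℤ × ℤ) : W2 :=
  ((1 + α.2 : ℤ) : ℂ) • ((X 0 ^ (α.1 + 1).toNat * X 1 ^ α.2.toNat : A2) • (pderiv 0 : W2)) -
    ((1 + α.1 : ℤ) : ℂ) • ((X 0 ^ α.1.toNat * X 1 ^ (α.2 + 1).toNat : A2) • (pderiv 1 : W2))

theorem derivationL_mem (α : ℤ × ℤ) (h : -1 ≤ α.1 ∧ -1 ≤ α.2) : derivationL α ∈ SBar := by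
  obtain ⟨a, b⟩ := α
  obtain ⟨h1, h2⟩ := h
  simp only at h1 h2
  obtain ⟨m, rfl⟩ : ∃ m : ℕ, a = (m : ℤ) - 1 := ⟨(a + 1).toNat, by omega⟩
  obtain ⟨n, rfl⟩ : ∃ n : ℕ, b = (n : ℤ) - 1 := ⟨(b + 1).toNat, by omega⟩
  refine ⟨0, ?_⟩
  have e2 : ∀ k : ℕ, ((k : ℤ) - 1).toNat = k - 1 := fun k => by omega
  simp [divergence, derivationL, pderiv_X, e2, MvPolynomial.smul_eq_C_mul]
  ring

/-- The element `L_α` of `S̄₂`, for `α ∈ ℤ²` with `α₁, α₂ ≥ -1` (and `0` for other `α`, which are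
never used). -/
def genL (α : ℤ × ℤ) : SBar :=
  if h : -1 ≤ α.1 ∧ -1 ≤ α.2 then ⟨derivationL α, derivationL_mem α h⟩ else 0

/-- The universal enveloping algebra `U(S̄₂)`. -/
abbrev U : Type := UniversalEnvelopingAlgebra ℂ SBar

/-- The canonical map `S̄₂ → U(S̄₂)`. -/
def toU (x : SBar) : U := UniversalEnvelopingAlgebra.ι ℂ x

theorem toU_lie (x y : SBar) : toU ⁅x, y⁆ = toU x * toU y - toU y * toU x := by
  let _ : LieRing U := LieRing.ofAssociativeRing
  exact (UniversalEnvelopingAlgebra.ι ℂ).map_lie x y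

theorem toU_partial_comm (i j : Fin 2) :
    toU (partialS i) * toU (partialS j) = toU (partialS j) * toU (partialS i) := by
  have h : ⁅partialS i, partialS j⁆ = 0 := by
    apply Subtype.ext
    apply Derivation.ext
    intro f
    change ⁅(pderiv i : W2), (pderiv j : W2)⁆ f = 0
    rw [Derivation.commutator_apply, pderiv_comm, sub_self]
  have h' := toU_lie (partialS i) (partialS j)
  rw [h] at h'
  have h0 : toU 0 = 0 := map_zero (UniversalEnvelopingAlgebra.ι ℂ)
  rw [h0] at h'
  exact sub_eq_zero.mp h'.symm

/-- The multiplicative set of all `∂₁^i ∂₂^j` in `U(S̄₂)`. -/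
def partialMonoid : Submonoid U where
  carrier := {u | ∃ i j : ℕ, u = toU (partialS 0) ^ i * toU (partialS 1) ^ j}
  one_mem' := ⟨0, 0, by simp⟩
  mul_mem' := by
    rintro _ _ ⟨i, j, rfl⟩ ⟨k, l, rfl⟩
    refine ⟨i + k, j + l, ?_⟩
    have h : Commute (toU (partialS 1) ^ j) (toU (partialS 0) ^ k) :=
      Commute.pow_pow (toU_partial_comm 1 0) j k
    rw [pow_add, pow_add, mul_assoc, ← mul_assoc (toU (partialS 1) ^ j), h.eq]
    simp only [mul_assoc]

/-! ### The Ore condition -/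

theorem leibniz_nilpotent_mul {R : Type*} [Ring R] (δ : R → R) (h0 : δ 0 = 0)
    (hadd : ∀ a b, δ (a + b) = δ a + δ b) (hmul : ∀ a b, δ (a * b) = δ a * b + a * δ b) :
    ∀ (N n m : ℕ) (a b : R), n + m = N → δ^[n] a = 0 → δ^[m] b = 0 → δ^[N] (a * b) = 0 := by
  have hz : ∀ k, δ^[k] 0 = 0 := fun k => Function.iterate_fixed h0 k
  have ha : ∀ k a b, δ^[k] (a + b) = δ^[k] a + δ^[k] b := by
    intro k
    induction k with
    | zero => simp
    | succ k ih => intro a b; simp only [Function.iterate_succ_apply, hadd, ih]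
  intro N
  induction N with
  | zero =>
    intro n m a b h h1 h2
    obtain ⟨rfl, rfl⟩ : n = 0 ∧ m = 0 := by omega
    simp only [Function.iterate_zero, id_eq] at h1
    simp [h1]
  | succ N ih =>
    intro n m a b h h1 h2
    rcases n with _ | n
    · simp only [Function.iterate_zero, id_eq] at h1
      rw [h1, zero_mul, hz]
    rcases m with _ | m
    · simp only [Function.iterate_zero, id_eq] at h2
      rw [h2, mul_zero, hz]
    rw [Function.iterate_succ_apply, hmul, ha,
      ih n (m + 1) (δ a) b (by omega) (by simpa using h1) h2,
      ih (n + 1) m a (δ b) (by omega) h1 (by simpa using h2), add_zero]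

theorem leibniz_nilpotent_add {R : Type*} [AddMonoid R] (δ : R → R) (h0 : δ 0 = 0)
    (hadd : ∀ a b, δ (a + b) = δ a + δ b) (n m : ℕ) (a b : R)
    (h1 : δ^[n] a = 0) (h2 : δ^[m] b = 0) : δ^[n + m] (a + b) = 0 := by
  have hz : ∀ k, δ^[k] 0 = 0 := fun k => Function.iterate_fixed h0 k
  have ha : ∀ k a b, δ^[k] (a + b) = δ^[k] a + δ^[k] b := by
    intro k
    induction k with
    | zero => simp
    | succ k ih => intro a b; simp only [Function.iterate_succ_apply, hadd, ih]
  rw [ha]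
  nth_rewrite 1 [add_comm n m]
  rw [Function.iterate_add_apply, h1, hz, Function.iterate_add_apply, h2, hz, add_zero]

theorem pderiv_nilpotent (j : Fin 2) (f : A2) : ∃ n : ℕ, (fun g : A2 => pderiv j g)^[n] f = 0 := by
  induction f using MvPolynomial.induction_on with
  | C a => exact ⟨1, by simp⟩
  | add p q hp hq =>
    obtain ⟨n, hn⟩ := hp
    obtain ⟨m, hm⟩ := hq
    exact ⟨n + m, leibniz_nilpotent_add _ (by simp) (by simp) n m p q hn hm⟩
  | mul_X p i hp =>
    obtain ⟨n, hn⟩ := hp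
    refine ⟨n + 2, leibniz_nilpotent_mul _ (by simp) (by simp) ?_ _ n 2 p (X i) rfl hn ?_⟩
    · intro a b
      simp only [Derivation.leibniz, smul_eq_mul]
      ring
    · simp only [Function.iterate_succ, Function.iterate_zero, Function.comp_apply, id_eq, pderiv_X,
        Pi.single_apply]
      split_ifs <;> simp

theorem lie_partial_nilpotent (j : Fin 2) (D : SBar) :
    ∃ n : ℕ, (fun E : SBar => ⁅partialS j, E⁆)^[n] D = 0 := by
  have key : ∀ (n : ℕ) (D : SBar) (i : Fin 2),
      (((fun E : SBar => ⁅partialS j, E⁆)^[n] D : SBar) : W2) (X i) =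
        (fun g : A2 => pderiv j g)^[n] ((D : W2) (X i)) := by
    intro n
    induction n with
    | zero => intro D i; rfl
    | succ n ih =>
      intro D i
      rw [Function.iterate_succ_apply, Function.iterate_succ_apply, ih]
      congr 1
      change ⁅(pderiv j : W2), (D : W2)⁆ (X i) = _
      rw [Derivation.commutator_apply]
      simp only [pderiv_X, Pi.single_apply]
      split_ifs <;> simp
  obtain ⟨n, hn⟩ := pderiv_nilpotent j ((D : W2) (X 0))
  obtain ⟨m, hm⟩ := pderiv_nilpotent j ((D : W2) (X 1))
  have hz : ∀ k, (fun g : A2 => pderiv j g)^[k] 0 = 0 :=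
    fun k => Function.iterate_fixed (by simp) k
  refine ⟨n + m, ?_⟩
  apply Subtype.ext
  apply MvPolynomial.derivation_ext
  intro i
  rw [key]
  fin_cases i
  · change (fun g : A2 => pderiv j g)^[n + m] ((D : W2) (X 0)) = 0
    rw [add_comm, Function.iterate_add_apply, hn, hz]
  · change (fun g : A2 => pderiv j g)^[n + m] ((D : W2) (X 1)) = 0
    rw [Function.iterate_add_apply, hm, hz]

/-- The commutator with `∂ⱼ` is locally nilpotent on `U(S̄₂)`. -/
theorem commutator_nilpotent (j : Fin 2) (u : U) :
    ∃ n : ℕ, (fun v : U => toU (partialS j) * v - v * toU (partialS j))^[n] u = 0 := by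
  set x := toU (partialS j) with hx
  obtain ⟨w, rfl⟩ : ∃ w, UniversalEnvelopingAlgebra.mkAlgHom ℂ SBar w = u :=
    RingCon.mkₐ_surjective _ u
  induction w using TensorAlgebra.induction with
  | algebraMap r =>
    refine ⟨1, ?_⟩
    simp only [Function.iterate_one, AlgHom.commutes]
    rw [Algebra.commutes, sub_self]
  | ι D =>
    obtain ⟨n, hn⟩ := lie_partial_nilpotent j D
    have key : ∀ (n : ℕ) (D : SBar), (fun v : U => x * v - v * x)^[n] (toU D) =
        toU ((fun E : SBar => ⁅partialS j, E⁆)^[n] D) := by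
      intro n
      induction n with
      | zero => intro D; rfl
      | succ n ih =>
        intro D
        rw [Function.iterate_succ_apply, Function.iterate_succ_apply, ← ih, toU_lie]
    refine ⟨n, ?_⟩
    change (fun v : U => x * v - v * x)^[n] (toU D) = 0
    rw [key, hn]
    exact map_zero (UniversalEnvelopingAlgebra.ι ℂ)
  | mul a b ha hb =>
    obtain ⟨n, hn⟩ := ha
    obtain ⟨m, hm⟩ := hb
    refine ⟨n + m, ?_⟩
    rw [map_mul]
    exact leibniz_nilpotent_mul _ (by simp) (fun a b => by noncomm_ring)
      (fun a b => by noncomm_ring) _ n m _ _ rfl hn hm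
  | add a b ha hb =>
    obtain ⟨n, hn⟩ := ha
    obtain ⟨m, hm⟩ := hb
    refine ⟨n + m, ?_⟩
    rw [map_add]
    exact leibniz_nilpotent_add _ (by simp) (fun a b => by noncomm_ring) n m _ _ hn hm

theorem ore_step {R : Type*} [Ring R] (x : R) (n : ℕ) (r : R)
    (h : (fun v : R => x * v - v * x)^[n] r = 0) : ∃ r', x ^ n * r = r' * x := by
  induction n generalizing r with
  | zero => exact ⟨0, by simpa using h⟩
  | succ n ih =>
    obtain ⟨r', hr'⟩ := ih (x * r - r * x) (by simpa using h)
    refine ⟨x ^ n * r + r', ?_⟩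
    rw [add_mul, ← hr']
    noncomm_ring

theorem ore_cancel_step {R : Type*} [Ring R] (x : R) (n : ℕ) (r : R)
    (h : (fun v : R => x * v - v * x)^[n] r = 0) (h0 : r * x = 0) : x ^ n * r = 0 := by
  induction n generalizing r with
  | zero => simpa using h
  | succ n ih =>
    have := ih (x * r - r * x) (by simpa using h) (by
      rw [sub_mul, mul_assoc, h0]; simp)
    rw [h0, sub_zero] at this
    rw [pow_succ, mul_assoc, this]

theorem ore_pow {R : Type*} [Ring R] (x : R)
    (hx : ∀ r, ∃ n : ℕ, (fun v : R => x * v - v * x)^[n] r = 0) (i : ℕ) (r : R) :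
    ∃ (n : ℕ) (r' : R), x ^ n * r = r' * x ^ i := by
  induction i with
  | zero => exact ⟨0, r, by simp⟩
  | succ i ih =>
    obtain ⟨n, r', h⟩ := ih
    obtain ⟨m, hm⟩ := hx r'
    obtain ⟨r'', h'⟩ := ore_step x m r' hm
    refine ⟨m + n, r'', ?_⟩
    rw [pow_add, mul_assoc, h, ← mul_assoc, h', mul_assoc, ← pow_succ']

theorem ore_cancel_pow {R : Type*} [Ring R] (x : R)
    (hx : ∀ r, ∃ n : ℕ, (fun v : R => x * v - v * x)^[n] r = 0) (i : ℕ) (r : R)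
    (h : r * x ^ i = 0) : ∃ n : ℕ, x ^ n * r = 0 := by
  induction i generalizing r with
  | zero => exact ⟨0, by simpa using h⟩
  | succ i ih =>
    obtain ⟨n, hn⟩ := ih (r * x) (by rw [mul_assoc, ← pow_succ', h])
    obtain ⟨m, hm⟩ := hx (x ^ n * r)
    refine ⟨m + n, ?_⟩
    rw [pow_add, mul_assoc]
    exact ore_cancel_step x m _ hm (by rw [mul_assoc, hn])

/-- The monomials in `∂₁, ∂₂` form an Ore set in `U(S̄₂)`. -/
theorem nonempty_oreSet : Nonempty (OreLocalization.OreSet partialMonoid) := by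
  have hc := toU_partial_comm 0 1
  rw [OreLocalization.nonempty_oreSet_iff]
  constructor
  · rintro r₁ r₂ ⟨_, i, j, rfl⟩ h
    have h' : ((r₁ - r₂) * toU (partialS 0) ^ i) * toU (partialS 1) ^ j = 0 := by
      rw [mul_assoc, sub_mul]
      exact sub_eq_zero.mpr h
    obtain ⟨n, hn⟩ := ore_cancel_pow _ (commutator_nilpotent 1) j _ h'
    rw [← mul_assoc] at hn
    obtain ⟨m, hm⟩ := ore_cancel_pow _ (commutator_nilpotent 0) i _ hn
    refine ⟨⟨_, m, n, rfl⟩, ?_⟩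
    rw [← mul_assoc, mul_sub] at hm
    exact sub_eq_zero.mp hm
  · rintro r ⟨_, i, j, rfl⟩
    obtain ⟨n, r', h⟩ := ore_pow _ (commutator_nilpotent 1) j r
    obtain ⟨m, r'', h'⟩ := ore_pow _ (commutator_nilpotent 0) i r'
    refine ⟨r'', ⟨_, m, n, rfl⟩, ?_⟩
    change toU (partialS 0) ^ m * toU (partialS 1) ^ n * r =
      r'' * (toU (partialS 0) ^ i * toU (partialS 1) ^ j)
    rw [mul_assoc, h, ← mul_assoc, h', mul_assoc]

instance oreSet : OreLocalization.OreSet partialMonoid := Classical.choice nonempty_oreSet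

/-- The localization `U₍₋₁₎` of `U(S̄₂)` at the Ore set of monomials in `∂₁, ∂₂`. -/
abbrev ULoc : Type := OreLocalization partialMonoid U

/-- The image of an element of `S̄₂` in `U₍₋₁₎`. -/
def toULoc (x : SBar) : ULoc := OreLocalization.numeratorHom (toU x)

/-- `∂ᵢ` as an invertible element of `U₍₋₁₎`. -/
def partialUnit (i : Fin 2) : ULocˣ :=
  OreLocalization.numeratorUnit
    (⟨toU (partialS i), by
      fin_cases i
      · exact ⟨1, 0, by simp⟩
      · exact ⟨0, 1, by simp⟩⟩ : partialMonoid)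

/-- `∂^β = ∂₁^{β₁} ∂₂^{β₂}` in `U₍₋₁₎`, for `β ∈ ℤ²`. -/
def partialPow (β : ℤ × ℤ) : ULoc :=
  ((partialUnit 0 ^ β.1 * partialUnit 1 ^ β.2 : ULocˣ) : ULoc)

/-- `dᵢ` in `U₍₋₁₎`. -/
def dLoc (i : Fin 2) : ULoc := toULoc (eulerS i)

/-- The subalgebra `H` of all `u ∈ U₍₋₁₎` that commute with `∂₁, ∂₂, d₁, d₂`. -/
def H : Subalgebra ℂ ULoc :=
  Subalgebra.centralizer ℂ
    {toULoc (partialS 0), toULoc (partialS 1), dLoc 0, dLoc 1}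

/-- The product `∏_{k = lo}^{hi} (x - k)` over integers `k`, equal to `1` when `hi < lo`. -/
def shiftProd (x : ULoc) (lo hi : ℤ) : ULoc :=
  ((List.range (hi + 1 - lo).toNat).map fun k : ℕ => x - ((lo + (k : ℤ) : ℤ) : ULoc)).prod

/-- The binomial coefficient `binom(α + 𝟏, β + 𝟏)` for `α, β ∈ ℤ²` with entries at least `-1`. -/
def binom (α β : ℤ × ℤ) : ℕ :=
  Nat.choose (α.1 + 1).toNat (β.1 + 1).toNat * Nat.choose (α.2 + 1).toNat (β.2 + 1).toNat

/-- The finite set of all `β ∈ ℤ²` with `β₁, β₂ ≥ -1`, `0 ≤ |β| < |α|` and `β ≠ 0`; the first three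
conditions force `β₁, β₂ ≤ |α|`. -/
def lowerSet (α : ℤ × ℤ) : Finset (ℤ × ℤ) :=
  (Finset.Icc (-1) (α.1 + α.2) ×ˢ Finset.Icc (-1) (α.1 + α.2)).filter
    fun β => 0 ≤ β.1 + β.2 ∧ β.1 + β.2 < α.1 + α.2 ∧ β ≠ 0

theorem mem_lowerSet (α β : ℤ × ℤ) :
    β ∈ lowerSet α ↔ -1 ≤ β.1 ∧ -1 ≤ β.2 ∧ 0 ≤ β.1 + β.2 ∧ β.1 + β.2 < α.1 + α.2 ∧ β ≠ 0 := by
  simp only [lowerSet, Finset.mem_filter, Finset.mem_product, Finset.mem_Icc]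
  constructor
  · rintro ⟨⟨⟨h1, _⟩, h2, _⟩, h3, h4, h5⟩
    exact ⟨h1, h2, h3, h4, h5⟩
  · rintro ⟨h1, h2, h3, h4, h5⟩
    exact ⟨⟨⟨h1, by omega⟩, h2, by omega⟩, h3, h4, h5⟩

/-- The element `Y_α` of `U₍₋₁₎`, for `α ∈ ℤ²` with `α₁, α₂ ≥ -1`, `|α| ≥ 0` and `α ≠ 0`. -/
def Y (α : ℤ × ℤ) : ULoc :=
  toULoc (genL α) * partialPow α +
  ∑ β ∈ lowerSet α,
    ((-1 : ℂ) ^ ((α.1 + α.2) - (β.1 + β.2)) * (binom α β : ℂ)) •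
      (toULoc (genL β) * shiftProd (dLoc 0) 0 (α.1 - β.1 - 1) *
        shiftProd (dLoc 1) 0 (α.2 - β.2 - 1) * partialPow β) +
  ((-1 : ℂ) ^ (α.1 + α.2) * ((α.1 * (α.2 + 1) : ℤ) : ℂ)) •
    (shiftProd (dLoc 0) (-1) (α.1 - 1) * shiftProd (dLoc 1) 0 (α.2 - 1)) +
  ((-1 : ℂ) ^ (α.1 + α.2 - 1) * (((α.1 + 1) * α.2 : ℤ) : ℂ)) •
    (shiftProd (dLoc 0) 0 (α.1 - 1) * shiftProd (dLoc 1) (-1) (α.2 - 1))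

/-- The indices of the elements `Y_α`: all `α ∈ ℤ²` with `α₁, α₂ ≥ -1`, `|α| ≥ 0` and `α ≠ 0`. As a
definition of its own it carries no order inherited from `ℤ × ℤ`. -/
def YIndex : Type := {α : ℤ × ℤ // -1 ≤ α.1 ∧ -1 ≤ α.2 ∧ 0 ≤ α.1 + α.2 ∧ α ≠ 0}

/-- The ordered monomial `Y_{α₁} Y_{α₂} ⋯ Y_{αₖ}`, where `α₁ ≤ α₂ ≤ ⋯ ≤ αₖ` are the members of the
multiset `s`; it is `1` for the empty multiset. -/
def orderedMonomial [LinearOrder YIndex] (s : Multiset YIndex) : ULoc :=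
  (s.sort.map fun α => Y α.1).prod

end SBarTwo

end

/-! In `U₍₋₁₎` the elements `tᵢ = dᵢ ∂ᵢ⁻¹` satisfy `[∂ᵢ, tⱼ] = δᵢⱼ`, so the Taylor expansion of
`L_α` around the point `(t₁, t₂)` commutes with `∂₁` and `∂₂`; multiplied by `∂^α` it has weight
zero, and this product is `Y_α`. The expansion is invertible, so `U₍₋₁₎` is generated by the `Y_α`
and the localized Weyl algebra `W` of `∂ᵢ^{±1}, dᵢ`. Whenever `V ⊆ H` satisfies `V W = U₍₋₁₎`, one
has `V = H`, since an element of `V W` that commutes with `W` lies in `V`. This applies to the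
span of the ordered monomials, because `[Y_α, Y_β]` has lower degree than `Y_α Y_β`, and to the
subalgebra generated by the four small `Y_α`, because `t₁`, `t₁² t₂` and `t₂²` generate all
monomial Hamiltonians under the Poisson bracket. The ordered monomials are independent because
their leading terms are, up to powers of `∂ᵢ`, distinct Poincaré–Birkhoff–Witt monomials in the
`L_α`. -/

noncomputable section

namespace SBarTwo

open Finset.HasAntidiagonal (antidiagonal)
open Finset.HasAntidiagonal.antidiagonal (fst_le)

section EnvelopingAlgebra

open scoped TensorProduct

attribute [local instance] LieRing.ofAssociativeRing

open UniversalEnvelopingAlgebra (ι lift lift_ι_apply)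

variable {K 𝔤 A I : Type*} [Field K] [LieRing 𝔤] [LieAlgebra K 𝔤] [Ring A] [Algebra K A]

/-- The algebra map `U(𝔤) → U(𝔤) ⊗ A`, `x ↦ x ⊗ 1 + 1 ⊗ ρ x`, induced by the comultiplication of
`U(𝔤)` and a representation `ρ` of `𝔤` in an associative algebra `A`. -/
def coaction (ρ : 𝔤 →ₗ⁅K⁆ A) :
    UniversalEnvelopingAlgebra K 𝔤 →ₐ[K] UniversalEnvelopingAlgebra K 𝔤 ⊗[K] A :=
  lift K
    { toFun := fun x => ι K x ⊗ₜ[K] (1 : A) + 1 ⊗ₜ[K] ρ x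
      map_add' := fun x y => by
        simp only [map_add, TensorProduct.add_tmul, TensorProduct.tmul_add]
        abel
      map_smul' := fun c x => by
        simp only [map_smul, TensorProduct.smul_tmul', TensorProduct.tmul_smul, RingHom.id_apply,
          smul_add]
      map_lie' := fun {x y} => by
        simp only [LieHom.map_lie, Ring.lie_def, add_mul, mul_add,
          Algebra.TensorProduct.tmul_mul_tmul, one_mul, mul_one, TensorProduct.sub_tmul,
          TensorProduct.tmul_sub]
        abel }

theorem coaction_ι (ρ : 𝔤 →ₗ⁅K⁆ A) (x : 𝔤) :
    coaction ρ (ι K x) = ι K x ⊗ₜ[K] (1 : A) + 1 ⊗ₜ[K] ρ x :=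
  lift_ι_apply K _ x

/-- The product in `U(𝔤)` of the elements `x i` along a word. -/
def wordProd (x : I → 𝔤) (l : List I) : UniversalEnvelopingAlgebra K 𝔤 :=
  (l.map fun i => ι K (x i)).prod

/-- The linear form `ψ ⊗ φ` on `U(𝔤) ⊗ A`. -/
def tensorForm (ψ : UniversalEnvelopingAlgebra K 𝔤 →ₗ[K] K) (φ : A →ₗ[K] K) :
    UniversalEnvelopingAlgebra K 𝔤 ⊗[K] A →ₗ[K] K :=
  LinearMap.mul' K K ∘ₗ TensorProduct.map ψ φ

/-- The iterated convolution of the linear forms `φ i` along a word, a linear form on `U(𝔤)`; the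
empty word gives the counit. -/
def convForm (ρ : 𝔤 →ₗ⁅K⁆ A) (φ : I → A →ₗ[K] K) :
    List I → UniversalEnvelopingAlgebra K 𝔤 →ₗ[K] K
  | [] => (lift K (0 : 𝔤 →ₗ⁅K⁆ K)).toLinearMap
  | i :: l => tensorForm (convForm ρ φ l) (φ i) ∘ₗ (coaction ρ).toLinearMap

section Form

variable (ρ : 𝔤 →ₗ⁅K⁆ A) (x : I → 𝔤) (ψ : UniversalEnvelopingAlgebra K 𝔤 →ₗ[K] K) (φ : A →ₗ[K] K)

theorem tensorForm_tmul_mul_coaction_nil (p : List I) (a : A) :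
    tensorForm ψ φ (wordProd x p ⊗ₜ a * coaction ρ (wordProd x ([] : List I))) =
      ψ (wordProd x p) * φ a := by
  simp [wordProd, tensorForm]

theorem tensorForm_tmul_mul_coaction_cons (p m : List I) (i : I) (a : A) :
    tensorForm ψ φ (wordProd x p ⊗ₜ a * coaction ρ (wordProd x (i :: m))) =
      tensorForm ψ φ (wordProd x (p ++ [i]) ⊗ₜ a * coaction ρ (wordProd x m)) +
      tensorForm ψ φ (wordProd x p ⊗ₜ (a * ρ (x i)) * coaction ρ (wordProd x m)) := by
  have coaction_cons : coaction ρ (wordProd x (i :: m)) =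
      (ι K (x i) ⊗ₜ[K] (1 : A) + 1 ⊗ₜ[K] ρ (x i)) * coaction ρ (wordProd x m) := by
    simp only [wordProd, List.map_cons, List.prod_cons, map_mul, coaction_ι]
  rw [coaction_cons, ← mul_assoc, mul_add, add_mul, map_add, Algebra.TensorProduct.tmul_mul_tmul,
    Algebra.TensorProduct.tmul_mul_tmul, mul_one, mul_one]
  simp [wordProd]

variable {ψ} {k : ℕ} (hψ : ∀ m : List I, m.length < k → ψ (wordProd x m) = 0)
include hψ

theorem tensorForm_tmul_mul_coaction_eq_zero (m p : List I) (a : A)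
    (h : p.length + m.length < k) :
    tensorForm ψ φ (wordProd x p ⊗ₜ a * coaction ρ (wordProd x m)) = 0 := by
  induction m generalizing p a with
  | nil => rw [tensorForm_tmul_mul_coaction_nil, hψ p (by simpa using h), zero_mul]
  | cons i m ih =>
    rw [List.length_cons] at h
    rw [tensorForm_tmul_mul_coaction_cons,
      ih _ _ (by simp only [List.length_append, List.length_singleton]; omega),
      ih _ _ (by omega), add_zero]

theorem tensorForm_tmul_mul_coaction_eq_mul (m p : List I) (a : A)
    (h : p.length + m.length = k) :
    tensorForm ψ φ (wordProd x p ⊗ₜ a * coaction ρ (wordProd x m)) =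
      ψ (wordProd x (p ++ m)) * φ a := by
  induction m generalizing p with
  | nil => rw [tensorForm_tmul_mul_coaction_nil, List.append_nil]
  | cons i m ih =>
    rw [List.length_cons] at h
    rw [tensorForm_tmul_mul_coaction_cons,
      ih _ (by simp only [List.length_append, List.length_singleton]; omega),
      tensorForm_tmul_mul_coaction_eq_zero ρ x φ hψ m _ _ (by omega), add_zero,
      List.append_assoc, List.singleton_append]

end Form

variable (ρ : 𝔤 →ₗ⁅K⁆ A) (x : I → 𝔤) (φ : I → A →ₗ[K] K) (hφ1 : ∀ i, φ i 1 = 0)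

theorem convForm_cons (i : I) (l m : List I) :
    convForm ρ φ (i :: l) (wordProd x m) = tensorForm (convForm ρ φ l) (φ i)
      (wordProd x ([] : List I) ⊗ₜ (1 : A) * coaction ρ (wordProd x m)) :=
  congrArg (tensorForm (convForm ρ φ l) (φ i)) (one_mul _).symm

include hφ1

theorem convForm_eq_zero (l m : List I) (h : m.length < l.length) :
    convForm ρ φ l (wordProd x m) = 0 := by
  induction l generalizing m with
  | nil => simp at h
  | cons i l ih =>
    rw [List.length_cons] at h
    rw [convForm_cons]
    rcases (Nat.le_of_lt_succ h).lt_or_eq with hlt | heq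
    · exact tensorForm_tmul_mul_coaction_eq_zero ρ x _ ih m _ _ (by simpa using hlt)
    · rw [tensorForm_tmul_mul_coaction_eq_mul ρ x _ ih m _ _ (by simpa using heq), hφ1, mul_zero]

variable [DecidableEq I] (hφ : ∀ i j, φ i (ρ (x j)) = if i = j then 1 else 0)
include hφ

/-- Each occurrence of the letter `i` in `m` contributes the summand in which the coaction moves
exactly this letter to the right tensor factor. -/
theorem tensorForm_convForm_eq_count {i : I} {l : List I} {c : K}
    (hc : ∀ m : List I, m.length = l.length →
      convForm ρ φ l (wordProd x m) = if m.Perm l then c else 0)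
    (m p : List I) (h : p.length + m.length = l.length + 1) :
    tensorForm (convForm ρ φ l) (φ i) (wordProd x p ⊗ₜ (1 : A) * coaction ρ (wordProd x m)) =
      if (p ++ m).Perm (i :: l) then m.count i * c else 0 := by
  induction m generalizing p with
  | nil => simp [tensorForm_tmul_mul_coaction_nil, hφ1]
  | cons j m ih =>
    rw [List.length_cons] at h
    rw [tensorForm_tmul_mul_coaction_cons,
      ih (p ++ [j]) (by simp only [List.length_append, List.length_singleton]; omega), one_mul,
      tensorForm_tmul_mul_coaction_eq_mul ρ x _ (convForm_eq_zero ρ x φ hφ1 l) m _ _ (by omega),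
      hc _ (by simp only [List.length_append]; omega), hφ,
      List.append_assoc, List.singleton_append]
    by_cases hij : i = j
    · subst hij
      have perm_iff : (p ++ i :: m).Perm (i :: l) ↔ (p ++ m).Perm l :=
        (List.perm_middle.congr_left _).trans (List.perm_cons i)
      by_cases hperm : (p ++ m).Perm l <;> simp [perm_iff, hperm, add_mul]
    · simp [hij, List.count_cons_of_ne (Ne.symm hij)]

theorem exists_convForm_eq_ite_perm [CharZero K] (l : List I) :
    ∃ c : K, c ≠ 0 ∧ ∀ m : List I, m.length = l.length →
      convForm ρ φ l (wordProd x m) = if m.Perm l then c else 0 := by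
  induction l with
  | nil =>
    refine ⟨1, one_ne_zero, fun m h => ?_⟩
    obtain rfl := List.length_eq_zero_iff.1 h
    simp [convForm, wordProd]
  | cons i l ih =>
    obtain ⟨c, hc0, hc⟩ := ih
    have count_ne_zero : ((i :: l).count i : K) ≠ 0 := by
      rw [List.count_cons_self]
      exact Nat.cast_ne_zero.2 (Nat.succ_ne_zero _)
    refine ⟨(i :: l).count i * c, mul_ne_zero count_ne_zero hc0, fun m h => ?_⟩
    rw [convForm_cons, tensorForm_convForm_eq_count ρ x φ hφ1 hφ hc m [] (by simpa using h),
      List.nil_append]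
    split_ifs with hperm
    · rw [hperm.count_eq]
    · rfl

/-- The independence part of the Poincaré–Birkhoff–Witt theorem, for letters which, together with
`1`, are separated by linear forms in some associative representation. -/
theorem linearIndependent_wordProd [CharZero K] {J : Type*} (w : J → List I)
    (hw : ∀ i j, (w i).Perm (w j) → i = j) :
    LinearIndependent K fun j => (wordProd x (w j) : UniversalEnvelopingAlgebra K 𝔤) := by
  rw [linearIndependent_iff]
  intro g hg
  by_contra hne
  obtain ⟨j₀, hj₀, hmax⟩ := g.support.exists_max_image (fun j => (w j).length)
    (Finsupp.support_nonempty_iff.2 hne)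
  obtain ⟨c, hc0, hc⟩ := exists_convForm_eq_ite_perm ρ x φ hφ1 hφ (w j₀)
  have vanish : ∀ j ∈ g.support, j ≠ j₀ → convForm ρ φ (w j₀) (wordProd x (w j)) = 0 := by
    intro j hj hjne
    rcases (hmax j hj).lt_or_eq with hlt | heq
    · exact convForm_eq_zero ρ x φ hφ1 _ _ hlt
    · rw [hc _ heq, if_neg fun hp => hjne (hw _ _ hp)]
  have h := congrArg (convForm ρ φ (w j₀)) hg
  rw [Finsupp.linearCombination_apply, Finsupp.sum, map_sum, map_zero,
    Finset.sum_eq_single_of_mem j₀ hj₀ (fun j hj hjne => by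
      rw [map_smul, vanish j hj hjne, smul_zero]),
    map_smul, hc _ rfl, if_pos (List.Perm.refl _)] at h
  exact (smul_ne_zero (Finsupp.mem_support_iff.1 hj₀) hc0) h

end EnvelopingAlgebra

section BinomialTransform

variable {R : Type*} [Ring R]

/-- The noncommutative umbral binomial `(ℓ - x) ^ m`: its expansion with `ℓ ^ i` replaced by the
term `ℓ i` of a sequence, and with the powers of `x` on the right. -/
def binomialTransform (x : R) (ℓ : ℕ → R) (m : ℕ) : R :=
  ∑ ij ∈ antidiagonal m, m.choose ij.1 • (ℓ ij.1 * (-x) ^ ij.2)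

variable {x : R} {ℓ : ℕ → R}

theorem binomialTransform_zero : binomialTransform x ℓ 0 = ℓ 0 := by
  simp [binomialTransform]

theorem binomialTransform_succ (m : ℕ) :
    binomialTransform x ℓ (m + 1) =
      binomialTransform x (fun j => ℓ (j + 1)) m - binomialTransform x ℓ m * x := by
  have choose_snd : ∀ ij ∈ antidiagonal m, m.choose ij.2 • (ℓ (ij.1 + 1) * (-x) ^ ij.2) =
      m.choose ij.1 • (ℓ (ij.1 + 1) * (-x) ^ ij.2) := fun ij hij => by
    rw [Nat.choose_symm_of_eq_add (Finset.HasAntidiagonal.mem_antidiagonal.1 hij).symm]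
  rw [binomialTransform, Finset.sum_antidiagonal_choose_succ_nsmul (fun i j => ℓ i * (-x) ^ j) m,
    Finset.sum_congr rfl choose_snd, add_comm, sub_eq_add_neg]
  simp only [binomialTransform, Finset.sum_mul, ← Finset.sum_neg_distrib, smul_mul_assoc,
    mul_assoc, pow_succ, mul_neg, smul_neg]

theorem binomialTransform_sub_mul {y : R} (hxy : Commute y x) (ℓ' : ℕ → R) (m : ℕ) :
    binomialTransform x (fun j => ℓ j - ℓ' j * y) m =
      binomialTransform x ℓ m - binomialTransform x ℓ' m * y := by
  simp only [binomialTransform, sub_mul, smul_sub, Finset.sum_sub_distrib, Finset.sum_mul,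
    smul_mul_assoc, mul_assoc, (hxy.neg_right.pow_right _).eq]

theorem binomialTransform_neg_binomialTransform (m : ℕ) :
    binomialTransform (-x) (binomialTransform x ℓ) m = ℓ m := by
  induction m generalizing ℓ with
  | zero => rw [binomialTransform_zero, binomialTransform_zero]
  | succ m ih =>
    rw [binomialTransform_succ, funext binomialTransform_succ,
      binomialTransform_sub_mul (Commute.refl x).neg_right, ih, ih]
    noncomm_ring

theorem commute_binomialTransform {a : R} (hx : Commute a x) (hℓ : ∀ j, Commute a (ℓ j)) (m : ℕ) :
    Commute a (binomialTransform x ℓ m) :=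
  Commute.sum_right _ _ _ fun _ _ =>
    ((hℓ _).mul_right (hx.neg_right.pow_right _)).smul_right _

theorem mul_binomialTransform {a : R} {ℓ' : ℕ → R} {c : ℕ} (hx : Commute a x)
    (hℓ : ∀ j, a * ℓ j = ℓ j * a + c • ℓ' j) (m : ℕ) :
    a * binomialTransform x ℓ m =
      binomialTransform x ℓ m * a + c • binomialTransform x ℓ' m := by
  simp only [binomialTransform, Finset.mul_sum, Finset.sum_mul, Finset.smul_sum,
    ← Finset.sum_add_distrib]
  refine Finset.sum_congr rfl fun ij _ => ?_
  rw [mul_smul_comm, ← mul_assoc, hℓ, add_mul, mul_assoc, (hx.neg_right.pow_right ij.2).eq,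
    smul_add, smul_mul_assoc, smul_mul_assoc, mul_assoc, smul_comm c]

theorem semiconjBy_binomialTransform {d : R} {c ε : ℤ} (hx : SemiconjBy x (d + ε) d)
    (hℓ : ∀ j : ℕ, SemiconjBy (ℓ j) (d + (c + j * ε : ℤ)) d) (m : ℕ) :
    SemiconjBy (binomialTransform x ℓ m) (d + (c + m * ε : ℤ)) d := by
  have neg_pow : ∀ n : ℕ, SemiconjBy ((-x) ^ n) (d + (n * ε : ℤ)) d := fun n => by
    induction n with
    | zero => simp
    | succ n ih =>
      have shift := hx.neg_left.add_right (Int.cast_commute (n * ε) (-x)).symm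
      rw [pow_succ, Nat.cast_succ, add_one_mul, add_comm _ ε, Int.cast_add, ← add_assoc]
      exact ih.mul_left shift
  rw [SemiconjBy, binomialTransform, Finset.sum_mul, Finset.mul_sum]
  refine Finset.sum_congr rfl fun ij hij => ?_
  have shift := (neg_pow ij.2).add_right (Int.cast_commute (c + ij.1 * ε) ((-x) ^ ij.2)).symm
  rw [add_assoc, ← Int.cast_add, add_comm (ij.2 * ε), add_assoc, ← add_mul, ← Nat.cast_add,
    Finset.HasAntidiagonal.mem_antidiagonal.1 hij] at shift
  rw [smul_mul_assoc, mul_smul_comm, ((hℓ ij.1).mul_left shift).eq]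

theorem binomialTransform_mem {S : Type*} [SetLike S R] [AddSubmonoidClass S R] {N : S} {m : ℕ}
    (h : ∀ j ≤ m, ∀ a, ℓ j * (-x) ^ a ∈ N) : binomialTransform x ℓ m ∈ N :=
  sum_mem fun _ hij => nsmul_mem (h _ (fst_le hij) _) _

theorem binomialTransform_sub_mem {S : Type*} [SetLike S R] [AddSubmonoidClass S R] {N : S} {m : ℕ}
    (h : ∀ j < m, ∀ a, ℓ j * (-x) ^ a ∈ N) : binomialTransform x ℓ m - ℓ m ∈ N := by
  have top_mem : (m, 0) ∈ antidiagonal m := by simp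
  rw [binomialTransform, ← Finset.add_sum_erase _ _ top_mem, Nat.choose_self, one_smul, pow_zero,
    mul_one, add_sub_cancel_left]
  refine sum_mem fun ij hij => nsmul_mem (h _ ?_ _) _
  rw [Finset.mem_erase, Finset.HasAntidiagonal.mem_antidiagonal, ne_eq, Prod.ext_iff] at hij
  dsimp only at hij
  omega

end BinomialTransform

section WeylPair

variable {R : Type*} [Ring R] {p x : R}

theorem mul_pow_of_mul_eq_add_one (h : p * x = x * p + 1) (n : ℕ) :
    p * x ^ n = x ^ n * p + n • x ^ (n - 1) := by
  induction n with
  | zero => simp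
  | succ n ih =>
    have pow_pred_mul : n • x ^ (n - 1) * x = n • x ^ n := by cases n <;> simp [pow_succ, mul_assoc]
    rw [pow_succ, ← mul_assoc, ih, add_mul, mul_assoc, h, pow_pred_mul, mul_add, mul_one,
      add_assoc, add_tsub_cancel_right, succ_nsmul', mul_assoc]

theorem mul_neg_pow_of_mul_eq_add_one (h : p * x = x * p + 1) (n : ℕ) :
    p * (-x) ^ n = (-x) ^ n * p - n • (-x) ^ (n - 1) := by
  have hneg : -p * -x = -x * -p + 1 := by rw [neg_mul_neg, neg_mul_neg, h]
  have hpow := mul_pow_of_mul_eq_add_one hneg n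
  rw [neg_mul, neg_eq_iff_eq_neg] at hpow
  rw [hpow, mul_neg, neg_add, neg_neg, sub_eq_add_neg]

theorem mul_binomialTransform_eq (h : p * x = x * p + 1) {ℓ : ℕ → R}
    (hℓ : ∀ j, p * ℓ j = ℓ j * p + j • ℓ (j - 1)) (m : ℕ) :
    p * binomialTransform x ℓ m = binomialTransform x ℓ m * p +
      (∑ ij ∈ antidiagonal m, (m.choose ij.1 * ij.1) • (ℓ (ij.1 - 1) * (-x) ^ ij.2) -
        ∑ ij ∈ antidiagonal m, (m.choose ij.1 * ij.2) • (ℓ ij.1 * (-x) ^ (ij.2 - 1))) := by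
  simp only [binomialTransform, Finset.mul_sum, Finset.sum_mul, ← Finset.sum_sub_distrib,
    ← Finset.sum_add_distrib]
  refine Finset.sum_congr rfl fun ij _ => ?_
  rw [mul_smul_comm, ← mul_assoc, hℓ, add_mul, mul_assoc, mul_neg_pow_of_mul_eq_add_one h,
    mul_sub, smul_add, smul_sub, mul_smul_comm, smul_mul_assoc, smul_mul_assoc, smul_smul,
    smul_smul, ← mul_assoc]
  abel

/-- The two halves of the Leibniz rule cancel, as for a function of `ℓ - x`. -/
theorem commute_binomialTransform_of_mul_eq (h : p * x = x * p + 1) {ℓ : ℕ → R}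
    (hℓ : ∀ j, p * ℓ j = ℓ j * p + j • ℓ (j - 1)) (m : ℕ) :
    Commute p (binomialTransform x ℓ m) := by
  rw [Commute, SemiconjBy, mul_binomialTransform_eq h hℓ, add_eq_left, sub_eq_zero]
  cases m with
  | zero => simp
  | succ n =>
    rw [Finset.Nat.sum_antidiagonal_succ, Finset.Nat.sum_antidiagonal_succ', mul_zero, mul_zero,
      zero_smul, zero_smul, zero_add, zero_add]
    refine Finset.sum_congr rfl fun ij hij => ?_
    rw [Nat.choose_succ_right_eq, ← Finset.HasAntidiagonal.mem_antidiagonal.1 hij, add_assoc,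
      Nat.add_sub_cancel_left, Nat.add_sub_cancel, Nat.add_sub_cancel]

end WeylPair

section SpanningFamilies

variable {K A ι : Type*} [CommSemiring K] [Semiring A] [Algebra K A]

theorem toSubmodule_adjoin_le_span_range {s : Set A} {g : ι → A}
    (one_mem : 1 ∈ Submodule.span K (Set.range g))
    (mul_mem : ∀ i, ∀ a ∈ s, g i * a ∈ Submodule.span K (Set.range g)) :
    (Algebra.adjoin K s).toSubmodule ≤ Submodule.span K (Set.range g) := by
  rw [Algebra.adjoin_eq_span, Submodule.span_le]
  intro u hu
  induction hu using Submonoid.closure_induction_right with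
  | one => exact one_mem
  | mul_right u _ a ha ih =>
    have span_le : Submodule.span K (Set.range g) ≤
        (Submodule.span K (Set.range g)).comap (LinearMap.mulRight K a) :=
      Submodule.span_le.2 (Set.range_subset_iff.2 fun i => mul_mem i a ha)
    exact span_le ih

theorem exists_finset_of_mem_span_range_mul {g : ι → A} {V : Submodule K A} {u : A}
    (hu : u ∈ Submodule.span K (Set.range g) * V) :
    ∃ (s : Finset ι) (v : ι → A), (∀ i, v i ∈ V) ∧ u = ∑ i ∈ s, g i * v i := by
  rw [Submodule.span_range_eq_iSup, Submodule.iSup_mul,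
    Submodule.mem_iSup_iff_exists_finsupp] at hu
  obtain ⟨f, hf, rfl⟩ := hu
  choose v hv hvf using fun i => Submodule.mem_span_singleton_mul.1 (hf i)
  exact ⟨f.support, v, hv, by simp only [hvf, Finsupp.sum]⟩

theorem toSubmodule_sup_le_mul_of_commute {S T : Subalgebra K A}
    (h : ∀ a ∈ S, ∀ b ∈ T, Commute a b) :
    (S ⊔ T).toSubmodule ≤ S.toSubmodule * T.toSubmodule := by
  set P := S.toSubmodule * T.toSubmodule with hP
  have one_mem : 1 ∈ P := mul_one (1 : A) ▸ Submodule.mul_mem_mul S.one_mem T.one_mem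
  have mul_le : P * P ≤ P := by
    have swap : T.toSubmodule * S.toSubmodule = P := (Submodule.mul_comm_of_commute h).symm
    rw [hP, mul_assoc, ← mul_assoc T.toSubmodule, swap, hP, mul_assoc,
      T.isIdempotentElem_toSubmodule.eq, ← mul_assoc, S.isIdempotentElem_toSubmodule.eq]
  have sup_le : S ⊔ T ≤
      P.toSubalgebra one_mem fun _ _ ha hb => mul_le (Submodule.mul_mem_mul ha hb) :=
    sup_le (fun a ha => mul_one a ▸ Submodule.mul_mem_mul ha T.one_mem)
      (fun b hb => one_mul b ▸ Submodule.mul_mem_mul S.one_mem hb)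
  exact sup_le

end SpanningFamilies

section LocalizedWeyl

variable {K A : Type*} [Field K] [Ring A] [Algebra K A] {d : A} {p : Aˣ}

theorem semiconjBy_zpow_add_intCast (h : SemiconjBy (p : A) d (d + 1)) (n : ℤ) :
    SemiconjBy ((p ^ n : Aˣ) : A) d (d + n) := by
  have shift : ∀ m : ℤ, SemiconjBy (p : A) (d + m) (d + (m + 1 : ℤ)) := fun m => by
    rw [Int.cast_add, Int.cast_one, add_comm (m : A), ← add_assoc]
    exact h.add_right (Int.cast_commute m (p : A)).symm
  induction n using Int.induction_on with
  | zero => simp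
  | succ n ih =>
    rw [add_comm (n : ℤ), zpow_one_add, ← add_comm (n : ℤ)]
    exact (shift n).mul_left ih
  | pred n ih =>
    have shift_inv := (shift (-n - 1)).units_inv_symm_left
    rw [sub_add_cancel] at shift_inv
    rw [sub_eq_neg_add, zpow_add, zpow_neg_one, ← sub_eq_neg_add]
    exact shift_inv.mul_left ih

variable (K d p) in
/-- The subalgebra generated by `p⁻¹`, `p` and `d`. If `p * d = (d + 1) * p`, it is the first Weyl
algebra generated by `x = d * p⁻¹` and `p`, localized at the powers of `p`. -/
def localizedWeyl : Subalgebra K A := Algebra.adjoin K {(p : A), ((p⁻¹ : Aˣ) : A), d}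

theorem localizedWeyl_le_span (h : SemiconjBy (p : A) d (d + 1)) {z : A}
    (mul_mem : ∀ (a : ℕ) (n : ℤ), z ^ a * d * ((p ^ n : Aˣ) : A) ∈
      Submodule.span K (Set.range fun i : ℕ × ℤ => z ^ i.1 * ((p ^ i.2 : Aˣ) : A))) :
    (localizedWeyl K d p).toSubmodule ≤
      Submodule.span K (Set.range fun i : ℕ × ℤ => z ^ i.1 * ((p ^ i.2 : Aˣ) : A)) := by
  set S := Submodule.span K (Set.range fun i : ℕ × ℤ => z ^ i.1 * ((p ^ i.2 : Aˣ) : A))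
  have mem : ∀ (a : ℕ) (n : ℤ), z ^ a * ((p ^ n : Aˣ) : A) ∈ S :=
    fun a n => Submodule.subset_span ⟨(a, n), rfl⟩
  refine toSubmodule_adjoin_le_span_range (by simpa using mem 0 0) ?_
  rintro ⟨a, n⟩ u (rfl | rfl | rfl)
  · simpa [zpow_add, mul_assoc] using mem a (n + 1)
  · simpa [zpow_add, mul_assoc] using mem a (n + -1)
  · have : z ^ a * ((p ^ n : Aˣ) : A) * u =
        z ^ a * u * ((p ^ n : Aˣ) : A) + n • (z ^ a * ((p ^ n : Aˣ) : A)) := by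
      rw [mul_assoc, (semiconjBy_zpow_add_intCast h n).eq, add_mul, mul_add, mul_assoc,
        ← zsmul_eq_mul, mul_smul_comm]
    rw [this]
    exact add_mem (mul_mem a n) (zsmul_mem (mem a n) n)

theorem localizedWeyl_le_span_mul_inv_pow (h : SemiconjBy (p : A) d (d + 1)) :
    (localizedWeyl K d p).toSubmodule ≤ Submodule.span K
      (Set.range fun i : ℕ × ℤ => (d * ((p⁻¹ : Aˣ) : A)) ^ i.1 * ((p ^ i.2 : Aˣ) : A)) :=
  localizedWeyl_le_span h fun a n => Submodule.subset_span ⟨(a + 1, 1 + n), by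
    simp only [pow_succ, zpow_one_add, Units.val_mul, mul_assoc, Units.inv_mul_cancel_left]⟩

theorem localizedWeyl_le_span_pow (h : SemiconjBy (p : A) d (d + 1)) :
    (localizedWeyl K d p).toSubmodule ≤
      Submodule.span K (Set.range fun i : ℕ × ℤ => d ^ i.1 * ((p ^ i.2 : Aˣ) : A)) :=
  localizedWeyl_le_span h fun a n => Submodule.subset_span ⟨(a + 1, n), by simp only [pow_succ]⟩

theorem commute_of_mem_localizedWeyl {v c : A} (hp : Commute v p) (hd : Commute v d)
    (hc : c ∈ localizedWeyl K d p) : Commute v c := by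
  have le_centralizer : localizedWeyl K d p ≤ Subalgebra.centralizer K {v} :=
    Algebra.adjoin_le fun a ha => by
      rcases ha with rfl | rfl | rfl
      exacts [fun w hw => hw ▸ hp.eq, fun w hw => hw ▸ hp.units_inv_right.eq,
        fun w hw => hw ▸ hd.eq]
  exact le_centralizer hc v rfl

theorem mul_mul_inv_eq_add_one (h : SemiconjBy (p : A) d (d + 1)) :
    (p : A) * (d * ((p⁻¹ : Aˣ) : A)) = d * ((p⁻¹ : Aˣ) : A) * p + 1 := by
  rw [← mul_assoc, h.eq, Units.mul_inv_cancel_right, Units.inv_mul_cancel_right]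

/-- The commutator with `p` acts as `d/dx` on polynomials in `x` over the commutant of `p`. -/
theorem mul_sum_pow_mul {p x : A} (h : p * x = x * p + 1) {w : ℕ → A} (hw : ∀ a, Commute p (w a))
    (N : ℕ) :
    p * ∑ a ∈ Finset.range (N + 1), x ^ a * w a =
      (∑ a ∈ Finset.range (N + 1), x ^ a * w a) * p +
        ∑ a ∈ Finset.range N, x ^ a * ((a + 1) • w (a + 1)) := by
  have commutator : ∀ a, p * (x ^ (a + 1) * w (a + 1)) =
      x ^ (a + 1) * w (a + 1) * p + x ^ a * ((a + 1) • w (a + 1)) := fun a => by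
    rw [← mul_assoc, mul_pow_of_mul_eq_add_one h, add_mul, mul_assoc, (hw _).eq, ← mul_assoc,
      smul_mul_assoc, mul_smul_comm, Nat.add_sub_cancel]
  simp only [Finset.sum_range_succ', pow_zero, one_mul, mul_add, Finset.mul_sum, commutator,
    Finset.sum_add_distrib, add_mul, Finset.sum_mul, (hw 0).eq]
  abel

theorem eq_zero_of_sum_pow_mul_eq_zero [IsAddTorsionFree A] {p x : A} (h : p * x = x * p + 1)
    {w : ℕ → A} (hw : ∀ a, Commute p (w a)) (N : ℕ)
    (hsum : ∑ a ∈ Finset.range N, x ^ a * w a = 0) : ∀ a < N, w a = 0 := by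
  induction N generalizing w with
  | zero => exact fun a ha => absurd ha a.not_lt_zero
  | succ N ih =>
    have derivative := mul_sum_pow_mul h hw N
    rw [hsum, mul_zero, zero_mul, zero_add] at derivative
    have succ_eq_zero : ∀ a < N, w (a + 1) = 0 := fun a ha =>
      (nsmul_eq_zero_iff_right a.succ_ne_zero).1
        (ih (fun a => (hw _).smul_right _) derivative.symm a ha)
    rw [Finset.sum_range_succ', Finset.sum_eq_zero fun a ha => by
      rw [succ_eq_zero a (Finset.mem_range.1 ha), mul_zero], zero_add, pow_zero, one_mul] at hsum
    rintro (_ | a) ha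
    exacts [hsum, succ_eq_zero a (Nat.lt_of_succ_lt_succ ha)]

theorem mem_of_commute_of_mem_span_pow_mul [IsAddTorsionFree A] {p x : A} (h : p * x = x * p + 1)
    {W : Submodule K A} (hW : ∀ w ∈ W, Commute p w) {u : A} (hp : Commute p u)
    (hu : u ∈ Submodule.span K (Set.range fun a : ℕ => x ^ a) * W) : u ∈ W := by
  obtain ⟨s, v, hv, hu⟩ := exists_finset_of_mem_span_range_mul hu
  set w : ℕ → A := fun a => if a ∈ s then v a else 0
  have hw : ∀ a, w a ∈ W := fun a => by
    by_cases ha : a ∈ s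
    · simpa only [w, ha, if_true] using hv a
    · simpa only [w, ha, if_false] using zero_mem W
  have hsum : u = ∑ a ∈ Finset.range (s.sup id + 1), x ^ a * w a := by
    simp only [hu, w, mul_ite, mul_zero, Finset.sum_ite_mem,
      Finset.inter_eq_right.2 s.subset_range_sup_succ]
  have derivative := mul_sum_pow_mul h (fun a => hW _ (hw a)) (s.sup id)
  rw [← hsum, hp.eq, left_eq_add] at derivative
  have succ_eq_zero : ∀ a < s.sup id, w (a + 1) = 0 := fun a ha =>
    (nsmul_eq_zero_iff_right a.succ_ne_zero).1 (eq_zero_of_sum_pow_mul_eq_zero h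
      (fun a => (hW _ (hw _)).smul_right _) _ derivative a ha)
  rw [hsum, Finset.sum_range_succ', Finset.sum_eq_zero fun a ha => by
    rw [succ_eq_zero a (Finset.mem_range.1 ha), mul_zero], zero_add, pow_zero, one_mul]
  exact hw 0

theorem mem_of_commute_of_mem_span_zpow_mul [CharZero K] (h : SemiconjBy (p : A) d (d + 1))
    {V : Submodule K A} (hV : ∀ v ∈ V, Commute d v) {u : A} (hd : Commute d u)
    (hu : u ∈ Submodule.span K (Set.range fun n : ℤ => ((p ^ n : Aˣ) : A)) * V) : u ∈ V := by
  obtain ⟨s, v, hv, rfl⟩ := exists_finset_of_mem_span_range_mul hu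
  let ad := LinearMap.mulLeft K d - LinearMap.mulRight K d
  have weight : ∀ n, ad (((p ^ n : Aˣ) : A) * v n) = (-n : K) • (((p ^ n : Aˣ) : A) * v n) := by
    intro n
    simp only [ad, LinearMap.sub_apply, LinearMap.mulLeft_apply, LinearMap.mulRight_apply]
    rw [mul_assoc, ← (hV _ (hv n)).eq, ← mul_assoc, ← mul_assoc,
      (semiconjBy_zpow_add_intCast h n).eq, ← sub_mul, add_mul, sub_add_cancel_left, neg_smul,
      neg_mul, ← zsmul_eq_mul, smul_mul_assoc, Int.cast_smul_eq_zsmul]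
  have hsum : ∑ n ∈ s, (-n : K) • (((p ^ n : Aˣ) : A) * v n) = 0 := by
    rw [← Finset.sum_congr rfl fun n _ => weight n, ← map_sum]
    exact sub_eq_zero.2 hd.eq
  have inj : Function.Injective fun n : ℤ => (-n : K) := neg_injective.comp Int.cast_injective
  have eq_zero := (iSupIndep_iff_finsetSum_eq_zero_imp_eq_zero _).1
    ((Module.End.eigenspaces_iSupIndep ad).comp inj) s _
    (fun n _ => Submodule.smul_mem _ _ (Module.End.mem_eigenspace_iff.2 (weight n))) hsum
  refine sum_mem fun n hn => ?_
  obtain h0 | h0 := smul_eq_zero.1 (eq_zero n hn)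
  · obtain rfl : n = 0 := by simpa using h0
    simpa using hv 0
  · rw [h0]
    exact zero_mem V

theorem mem_of_mem_localizedWeyl_mul [CharZero K] (h : SemiconjBy (p : A) d (d + 1))
    {V : Submodule K A} (hVp : ∀ v ∈ V, Commute (p : A) v) (hVd : ∀ v ∈ V, Commute d v) {u : A}
    (hp : Commute (p : A) u) (hd : Commute d u)
    (hu : u ∈ (localizedWeyl K d p).toSubmodule * V) : u ∈ V := by
  have : IsAddTorsionFree A := .of_isTorsionFree K A
  set P := Submodule.span K (Set.range fun n : ℤ => ((p ^ n : Aˣ) : A))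
  have le_mul : (localizedWeyl K d p).toSubmodule ≤
      Submodule.span K (Set.range fun a : ℕ => (d * ((p⁻¹ : Aˣ) : A)) ^ a) * P := by
    rw [Submodule.span_mul_span]
    refine (localizedWeyl_le_span_mul_inv_pow h).trans (Submodule.span_mono ?_)
    rintro _ ⟨⟨a, n⟩, rfl⟩
    exact Set.mul_mem_mul ⟨a, rfl⟩ ⟨n, rfl⟩
  have commute_of_mem : ∀ w ∈ P * V, Commute (p : A) w := fun w hw => by
    obtain ⟨s, v, hv, rfl⟩ := exists_finset_of_mem_span_range_mul hw
    exact Commute.sum_right _ _ _ fun n _ =>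
      ((Commute.refl (p : A)).units_zpow_right n).mul_right (hVp _ (hv n))
  have hu' : u ∈ P * V := mem_of_commute_of_mem_span_pow_mul (mul_mul_inv_eq_add_one h)
    commute_of_mem hp (mul_assoc _ P V ▸ mul_le_mul_left le_mul V hu)
  exact mem_of_commute_of_mem_span_zpow_mul h hVd hd hu'

end LocalizedWeyl

section FilteredWords

variable {K A I : Type*} [CommRing K] [Ring A] [Algebra K A] {C : Subalgebra K A} {deg : I → ℕ}
  {y : I → A}

variable (C deg y) in
/-- The span of the products `y i₁ ⋯ y iₖ * c` with `c ∈ C` and `deg i₁ + ⋯ + deg iₖ < n`. The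
strict inequality makes the term of index `0` vanish. -/
def wordFiltration (n : ℕ) : Submodule K A :=
  Submodule.span K ((fun l : List I => (l.map y).prod) '' {l | (l.map deg).sum < n}) * C.toSubmodule

theorem prod_mul_mem_wordFiltration {l : List I} {n : ℕ} (hl : (l.map deg).sum < n) {c : A}
    (hc : c ∈ C) : (l.map y).prod * c ∈ wordFiltration C deg y n :=
  Submodule.mul_mem_mul (Submodule.subset_span ⟨l, hl, rfl⟩) hc

theorem prod_mem_wordFiltration {l : List I} {n : ℕ} (hl : (l.map deg).sum < n) :
    (l.map y).prod ∈ wordFiltration C deg y n := by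
  simpa only [mul_one] using prod_mul_mem_wordFiltration hl C.one_mem

theorem mem_wordFiltration_succ (i : I) : y i ∈ wordFiltration C deg y (deg i + 1) := by
  simpa using prod_mem_wordFiltration (C := C) (y := y) (deg := deg) (l := [i])
    (by simp)

theorem mem_wordFiltration_of_mem {n : ℕ} (hn : 0 < n) {c : A} (hc : c ∈ C) :
    c ∈ wordFiltration C deg y n := by
  simpa using prod_mul_mem_wordFiltration (y := y) (deg := deg) (l := [])
    (by simpa using hn) hc

theorem wordFiltration_mono : Monotone (wordFiltration C deg y) := fun _ _ h =>
  mul_le_mul_left (Submodule.span_mono (Set.image_mono fun _ hl => lt_of_lt_of_le hl h)) _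

theorem wordFiltration_le {n : ℕ} {N : Submodule K A}
    (h : ∀ l : List I, (l.map deg).sum < n → ∀ c ∈ C, (l.map y).prod * c ∈ N) :
    wordFiltration C deg y n ≤ N := by
  refine Submodule.mul_le.2 fun u hu c hc => ?_
  have span_le :
      Submodule.span K ((fun l : List I => (l.map y).prod) '' {l | (l.map deg).sum < n}) ≤
        N.comap (LinearMap.mulRight K c) :=
    Submodule.span_le.2 (Set.image_subset_iff.2 fun l hl => h l hl c hc)
  exact span_le hu

variable (hC : ∀ i, ∀ c ∈ C, Commute (y i) c)
include hC

theorem wordFiltration_mul_le (m n : ℕ) :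
    wordFiltration C deg y m * wordFiltration C deg y n ≤ wordFiltration C deg y (m + n - 1) := by
  set W : ℕ → Submodule K A := fun k =>
    Submodule.span K ((fun l : List I => (l.map y).prod) '' {l | (l.map deg).sum < k})
  have W_mul_le : W m * W n ≤ W (m + n - 1) := by
    rw [Submodule.span_mul_span]
    refine Submodule.span_mono ?_
    rintro _ ⟨_, ⟨l, hl, rfl⟩, _, ⟨l', hl', rfl⟩, rfl⟩
    refine ⟨l ++ l', ?_, by simp only [List.map_append, List.prod_append]⟩
    simp only [Set.mem_ofPred_eq, List.map_append, List.sum_append] at hl hl' ⊢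
    omega
  have C_mul_W : C.toSubmodule * W n = W n * C.toSubmodule := by
    refine Submodule.mul_comm_of_commute fun c hc u hu => ?_
    have span_le : W n ≤ (Subalgebra.centralizer K {c}).toSubmodule :=
      Submodule.span_le.2 (Set.image_subset_iff.2 fun l _ => ?_)
    · exact span_le hu c rfl
    · rintro _ rfl
      exact (Commute.list_prod_right _ _ (List.forall_mem_map.2 fun i _ => (hC i _ hc).symm)).eq
  calc W m * C.toSubmodule * (W n * C.toSubmodule)
      = W m * W n * (C.toSubmodule * C.toSubmodule) := by
        rw [mul_assoc, ← mul_assoc C.toSubmodule, C_mul_W]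
        simp only [mul_assoc]
    _ ≤ W (m + n - 1) * C.toSubmodule := by
        rw [C.isIdempotentElem_toSubmodule.eq]
        exact mul_le_mul_left W_mul_le _

theorem mul_mem_wordFiltration {m n k : ℕ} (hk : m + n ≤ k + 1) {u v : A}
    (hu : u ∈ wordFiltration C deg y m) (hv : v ∈ wordFiltration C deg y n) :
    u * v ∈ wordFiltration C deg y k :=
  wordFiltration_mono (by omega) (wordFiltration_mul_le hC m n (Submodule.mul_mem_mul hu hv))

theorem prod_sub_prod_mem_wordFiltration
    (hlie : ∀ i j, y i * y j - y j * y i ∈ wordFiltration C deg y (deg i + deg j))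
    {l l' : List I} (h : l.Perm l') :
    (l.map y).prod - (l'.map y).prod ∈ wordFiltration C deg y (l.map deg).sum := by
  induction h with
  | nil => simp
  | cons i _ ih =>
    simp only [List.map_cons, List.prod_cons, List.sum_cons, ← mul_sub]
    exact mul_mem_wordFiltration hC (by omega) (mem_wordFiltration_succ i) ih
  | swap i j l =>
    simp only [List.map_cons, List.prod_cons, List.sum_cons, ← mul_assoc, ← sub_mul]
    exact mul_mem_wordFiltration hC (by omega) (hlie j i)
      (prod_mem_wordFiltration (Nat.lt_succ_self _))
  | trans h _ ih ih' =>
    rw [← sub_add_sub_cancel]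
    exact add_mem ih ((h.map deg).sum_eq ▸ ih')

theorem prod_sub_prod_mul_prod_mem_wordFiltration {z u : I → A}
    (hz : ∀ i, z i ∈ wordFiltration C deg y (deg i + 1)) (hu : ∀ i, u i ∈ C)
    (hcomm : ∀ i j, Commute (u i) (u j))
    (h : ∀ i, y i - z i * u i ∈ wordFiltration C deg y (deg i)) (l : List I) :
    (l.map y).prod - (l.map z).prod * (l.map u).prod ∈ wordFiltration C deg y (l.map deg).sum := by
  induction l with
  | nil => simp
  | cons i l ih =>
    have prod_eq : ((i :: l).map y).prod - ((i :: l).map z).prod * ((i :: l).map u).prod =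
        (y i - z i * u i) * (l.map y).prod +
          z i * (((l.map y).prod - (l.map z).prod * (l.map u).prod) * u i) := by
      have commute_y : Commute (u i) (l.map y).prod :=
        Commute.list_prod_right _ _ (List.forall_mem_map.2 fun j _ => (hC j _ (hu i)).symm)
      have commute_u : Commute (u i) (l.map u).prod :=
        Commute.list_prod_right _ _ (List.forall_mem_map.2 fun j _ => hcomm i j)
      simp only [List.map_cons, List.prod_cons, sub_mul, mul_sub, mul_assoc, commute_y.eq,
        commute_u.eq]
      abel
    rw [prod_eq, List.map_cons, List.sum_cons]
    exact add_mem
      (mul_mem_wordFiltration hC (by omega) (h i) (prod_mem_wordFiltration (Nat.lt_succ_self _)))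
      (mul_mem_wordFiltration hC (by omega) (hz i)
        (mul_mem_wordFiltration hC le_rfl ih (mem_wordFiltration_of_mem one_pos (hu i))))

theorem wordFiltration_le_of_sorted [LinearOrder I]
    (hlie : ∀ i j, y i * y j - y j * y i ∈ wordFiltration C deg y (deg i + deg j))
    {N : ℕ → Submodule K A} (hN : Monotone N)
    (h : ∀ s : Multiset I, ∀ c ∈ C, ∃ v ∈ N ((s.map deg).sum + 1),
      (s.sort.map y).prod * c - v ∈ wordFiltration C deg y (s.map deg).sum) (n : ℕ) :
    wordFiltration C deg y n ≤ N n := by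
  induction n with
  | zero => exact wordFiltration_le fun _ hl => absurd hl (Nat.not_lt_zero _)
  | succ n ih =>
    refine wordFiltration_le fun l hl c hc => ?_
    have perm : l.Perm (l : Multiset I).sort := by rw [← Multiset.coe_eq_coe, Multiset.sort_eq]
    have lower := mul_mem_wordFiltration hC le_rfl
      (prod_sub_prod_mem_wordFiltration hC hlie perm) (mem_wordFiltration_of_mem one_pos hc)
    obtain ⟨v, hv, hsub⟩ := h l c hc
    rw [Multiset.map_coe, Multiset.sum_coe] at hv hsub
    have sub_mem : (l.map y).prod * c - v ∈ N n := by
      rw [sub_mul] at lower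
      refine ih (wordFiltration_mono (Nat.le_of_lt_succ hl) ?_)
      simpa only [sub_add_sub_cancel] using add_mem lower hsub
    simpa only [sub_add_cancel] using add_mem (hN n.le_succ sub_mem) (hN hl hv)

end FilteredWords

theorem linearIndependent_of_sub_mem_span {K M ι κ : Type*} [Ring K] [AddCommGroup M]
    [Module K M] {v : κ → M} (hv : LinearIndependent K v) (deg : κ → ℕ) {e : ι → κ}
    (he : Function.Injective e) {y : ι → M}
    (hy : ∀ i, y i - v (e i) ∈ Submodule.span K (v '' {j | deg j < deg (e i)})) :
    LinearIndependent K y := by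
  choose r hr hry using fun i => (Finsupp.mem_span_image_iff_linearCombination K).1 (hy i)
  have y_eq : y = Finsupp.linearCombination K v ∘ fun i => Finsupp.single (e i) 1 + r i := by
    funext i
    simp [hry]
  rw [y_eq]
  refine LinearIndependent.map' ?_ _ (LinearMap.ker_eq_bot.2 hv)
  classical
  refine linearIndependent_iff'.2 fun s c hc => ?_
  by_contra! hne
  obtain ⟨i₀, hi₀, hmax⟩ := {i ∈ s | c i ≠ 0}.exists_max_image (fun i => deg (e i))
    (hne.imp fun _ => Finset.mem_filter.2)
  rw [Finset.mem_filter] at hi₀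
  have r_apply : ∀ i ∈ s, c i ≠ 0 → r i (e i₀) = 0 := fun i hi hci =>
    Finsupp.notMem_support_iff.1 fun hmem => (Set.mem_ofPred.1 (hr i hmem)).not_ge
      (hmax i (Finset.mem_filter.2 ⟨hi, hci⟩))
  have coeff : ∀ i ∈ s, i ≠ i₀ → (c i • (Finsupp.single (e i) 1 + r i) : κ →₀ K) (e i₀) = 0 := by
    intro i hi hne
    by_cases hci : c i = 0
    · simp [hci]
    · simp [r_apply i hi hci, he.ne hne]
  have coeff_eq_zero := DFunLike.congr_fun hc (e i₀)
  rw [Finsupp.finsetSum_apply, Finset.sum_eq_single_of_mem i₀ hi₀.1 coeff] at coeff_eq_zero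
  exact hi₀.2 (by simpa [r_apply i₀ hi₀.1 hi₀.2] using coeff_eq_zero)

open MvPolynomial

section Antiderivative

variable {σ K : Type*} [Field K]

/-- Termwise integration of polynomials with respect to the variable `i`. -/
def antideriv (i : σ) : MvPolynomial σ K →ₗ[K] MvPolynomial σ K :=
  (basisMonomials σ K).constr K fun s => monomial (s + Finsupp.single i 1) ((s i : K) + 1)⁻¹

theorem antideriv_monomial (i : σ) (s : σ →₀ ℕ) (a : K) :
    antideriv i (monomial s a) = monomial (s + Finsupp.single i 1) (a * ((s i : K) + 1)⁻¹) := by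
  have basis_eq : antideriv i (monomial s (1 : K)) =
      monomial (s + Finsupp.single i 1) ((s i : K) + 1)⁻¹ := by
    simpa only [coe_basisMonomials, antideriv] using (basisMonomials σ K).constr_basis K
      (fun s => monomial (s + Finsupp.single i 1) ((s i : K) + 1)⁻¹) s
  rw [← mul_one a, ← smul_eq_mul, ← smul_monomial, map_smul, basis_eq, smul_monomial, smul_eq_mul,
    smul_eq_mul, mul_one]

theorem pderiv_antideriv [CharZero K] (i : σ) (f : MvPolynomial σ K) :
    pderiv i (antideriv i f) = f := by
  induction f using MvPolynomial.induction_on' with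
  | monomial s a =>
    rw [antideriv_monomial, pderiv_monomial, add_tsub_cancel_right, Finsupp.add_apply,
      Finsupp.single_eq_same, Nat.cast_add, Nat.cast_one,
      inv_mul_cancel_right₀ (Nat.cast_add_one_ne_zero _)]
  | add f g hf hg => rw [map_add, map_add, hf, hg]

theorem pderiv_antideriv_of_ne {i j : σ} (h : i ≠ j) (f : MvPolynomial σ K) :
    pderiv j (antideriv i f) = antideriv i (pderiv j f) := by
  induction f using MvPolynomial.induction_on' with
  | monomial s a =>
    have exponent_i : (s - Finsupp.single j 1 : σ →₀ ℕ) i = s i := by simp [h.symm]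
    have exponent_j : (s + Finsupp.single i 1 : σ →₀ ℕ) j = s j := by simp [h]
    rw [antideriv_monomial, pderiv_monomial, pderiv_monomial, antideriv_monomial, exponent_i,
      exponent_j, mul_right_comm]
    rcases Nat.eq_zero_or_pos (s j) with hs | hs
    · simp [hs]
    · rw [tsub_add_eq_add_tsub (Finsupp.single_le_iff.2 hs)]
  | add f g hf hg => simp only [map_add, hf, hg]

end Antiderivative

section HamiltonianFields

theorem W2_ext {D E : W2} (h0 : D (X 0) = E (X 0)) (h1 : D (X 1) = E (X 1)) : D = E :=
  MvPolynomial.derivation_ext (Fin.forall_fin_two.2 ⟨h0, h1⟩)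

/-- The Hamiltonian vector field `∂₂(f) ∂₁ - ∂₁(f) ∂₂` of a polynomial `f`. -/
def hamiltonian : A2 →ₗ[ℂ] W2 where
  toFun f := pderiv 1 f • (pderiv 0 : W2) - pderiv 0 f • (pderiv 1 : W2)
  map_add' f g := by simp only [map_add, add_smul]; abel
  map_smul' c f := by
    simp only [Derivation.map_smul, smul_assoc, smul_sub, RingHom.id_apply]

theorem hamiltonian_apply (f g : A2) :
    hamiltonian f g = pderiv 1 f * pderiv 0 g - pderiv 0 f * pderiv 1 g := by
  simp [hamiltonian]

theorem hamiltonian_X_zero (f : A2) : hamiltonian f (X 0) = pderiv 1 f := by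
  simp [hamiltonian_apply, pderiv_X]

theorem hamiltonian_X_one (f : A2) : hamiltonian f (X 1) = -pderiv 0 f := by
  simp [hamiltonian_apply, pderiv_X]

theorem divergence_hamiltonian (f : A2) : divergence (hamiltonian f) = 0 := by
  simp [divergence, hamiltonian_X_zero, hamiltonian_X_one, pderiv_comm 1 0 f]

theorem exists_hamiltonian_eq_of_divergence_eq_zero {D : W2} (hD : divergence D = 0) :
    ∃ f, hamiltonian f = D := by
  set f₀ := antideriv 1 (D (X 0))
  have pderiv_f₀ : pderiv 1 f₀ = D (X 0) := pderiv_antideriv 1 _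
  set r := D (X 1) + pderiv 0 f₀ with hr
  have pderiv_r : pderiv 1 r = 0 := by
    rw [hr, map_add, pderiv_comm 1 0, pderiv_f₀, ← hD, divergence, Fin.sum_univ_two, add_comm]
  refine ⟨f₀ - antideriv 0 r, W2_ext ?_ ?_⟩
  · rw [hamiltonian_X_zero, map_sub, pderiv_f₀, pderiv_antideriv_of_ne (by decide), pderiv_r,
      map_zero, sub_zero]
  · rw [hamiltonian_X_one, map_sub, pderiv_antideriv, hr, neg_sub, add_sub_cancel_right]

/-- The Hamiltonian vector field of a polynomial as an element of `S̄₂`. -/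
def hamS : A2 →ₗ[ℂ] SBar where
  toFun f := ⟨hamiltonian f, 0, by rw [divergence_hamiltonian, map_zero]⟩
  map_add' f g := Subtype.ext (map_add hamiltonian f g)
  map_smul' c f := Subtype.ext (map_smul hamiltonian c f)

theorem exists_eq_smul_eulerS_add_hamS (D : SBar) :
    ∃ (c : ℂ) (f : A2), D = c • eulerS 1 + hamS f := by
  obtain ⟨D, c, hc⟩ := D
  have divergence_sub : divergence (D - c • ((X 1 : A2) • (pderiv 1 : W2))) = 0 := by
    have : divergence (D - c • ((X 1 : A2) • (pderiv 1 : W2))) = divergence D - C c := by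
      simp [divergence, pderiv_X, MvPolynomial.smul_eq_C_mul, add_sub_assoc]
    rw [this, hc, sub_self]
  obtain ⟨f, hf⟩ := exists_hamiltonian_eq_of_divergence_eq_zero divergence_sub
  exact ⟨c, f, Subtype.ext (sub_eq_iff_eq_add'.1 hf.symm)⟩

theorem lie_hamS (f g : A2) :
    ⁅hamS f, hamS g⁆ = hamS (pderiv 1 f * pderiv 0 g - pderiv 0 f * pderiv 1 g) := by
  refine Subtype.ext (W2_ext ?_ ?_)
  · change ⁅hamiltonian f, hamiltonian g⁆ (X 0) = hamiltonian _ (X 0)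
    rw [Derivation.commutator_apply, hamiltonian_X_zero, hamiltonian_X_zero, hamiltonian_X_zero,
      hamiltonian_apply, hamiltonian_apply]
    simp only [map_sub, Derivation.leibniz, smul_eq_mul]
    rw [pderiv_comm 1 0 f, pderiv_comm 1 0 g]
    ring
  · change ⁅hamiltonian f, hamiltonian g⁆ (X 1) = hamiltonian _ (X 1)
    rw [Derivation.commutator_apply, hamiltonian_X_one, hamiltonian_X_one, hamiltonian_X_one,
      hamiltonian_apply, hamiltonian_apply]
    simp only [map_sub, map_neg, Derivation.leibniz, smul_eq_mul]
    rw [pderiv_comm 1 0 f, pderiv_comm 1 0 g]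
    ring

theorem lie_partialS_hamS (i : Fin 2) (f : A2) : ⁅partialS i, hamS f⁆ = hamS (pderiv i f) := by
  refine Subtype.ext (W2_ext ?_ ?_)
  · change ⁅(pderiv i : W2), hamiltonian f⁆ (X 0) = hamiltonian _ (X 0)
    simp only [Derivation.commutator_apply, hamiltonian_X_zero, pderiv_comm i 1]
    fin_cases i <;> simp [pderiv_X]
  · change ⁅(pderiv i : W2), hamiltonian f⁆ (X 1) = hamiltonian _ (X 1)
    simp only [Derivation.commutator_apply, hamiltonian_X_one, map_neg, pderiv_comm i 0]
    fin_cases i <;> simp [pderiv_X]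

theorem lie_eulerS_hamS (i : Fin 2) (f : A2) :
    ⁅eulerS i, hamS f⁆ = hamS (X i * pderiv i f - f) := by
  refine Subtype.ext ?_
  change ⁅(X i : A2) • (pderiv i : W2), hamiltonian f⁆ = hamiltonian _
  apply W2_ext <;> fin_cases i <;>
    simp [Derivation.commutator_apply, hamiltonian_apply, pderiv_X, pderiv_comm 1 0 f]

theorem lie_partialS_eulerS (i j : Fin 2) :
    ⁅partialS i, eulerS j⁆ = if i = j then partialS i else 0 := by
  refine Subtype.ext ?_
  change ⁅(pderiv i : W2), (X j : A2) • (pderiv j : W2)⁆ = _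
  apply W2_ext <;> fin_cases i <;> fin_cases j <;>
    simp [Derivation.commutator_apply, partialS, pderiv_X]

theorem lie_eulerS (i j : Fin 2) : ⁅eulerS i, eulerS j⁆ = 0 := by
  refine Subtype.ext ?_
  change ⁅(X i : A2) • (pderiv i : W2), (X j : A2) • (pderiv j : W2)⁆ = 0
  apply W2_ext <;> fin_cases i <;> fin_cases j <;>
    simp [Derivation.commutator_apply, pderiv_X]

end HamiltonianFields

section Monomials

/-- The monomial `t₁ʲ t₂ᵏ`. -/
def tPow (j k : ℕ) : A2 := X 0 ^ j * X 1 ^ k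

theorem monomial_eq_smul_tPow (s : Fin 2 →₀ ℕ) (a : ℂ) :
    monomial s a = a • tPow (s 0) (s 1) := by
  rw [monomial_eq, MvPolynomial.smul_eq_C_mul, tPow, Finsupp.prod_fintype _ _ (by simp),
    Fin.prod_univ_two]

theorem pderiv_zero_tPow (j k : ℕ) : pderiv 0 (tPow j k) = (j : ℂ) • tPow (j - 1) k := by
  rw [tPow, pderiv_mul, pderiv_pow, pderiv_pow, pderiv_X_self, pderiv_X_of_ne one_ne_zero,
    mul_zero, mul_zero, add_zero, mul_one, tPow, MvPolynomial.smul_eq_C_mul, map_natCast, mul_assoc]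

theorem pderiv_one_tPow (j k : ℕ) : pderiv 1 (tPow j k) = (k : ℂ) • tPow j (k - 1) := by
  rw [tPow, pderiv_mul, pderiv_pow, pderiv_pow, pderiv_X_self, pderiv_X_of_ne zero_ne_one,
    mul_zero, zero_mul, zero_add, mul_one, tPow, MvPolynomial.smul_eq_C_mul, map_natCast,
    mul_left_comm]

theorem X_zero_mul_pderiv_tPow (j k : ℕ) : X 0 * pderiv 0 (tPow j k) = (j : ℂ) • tPow j k := by
  cases j with
  | zero => simp [pderiv_zero_tPow]
  | succ j => rw [pderiv_zero_tPow, mul_smul_comm, tPow, tPow, Nat.add_sub_cancel, pow_succ',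
      mul_assoc]

theorem X_one_mul_pderiv_tPow (j k : ℕ) : X 1 * pderiv 1 (tPow j k) = (k : ℂ) • tPow j k := by
  cases k with
  | zero => simp [pderiv_one_tPow]
  | succ k => rw [pderiv_one_tPow, mul_smul_comm, tPow, tPow, Nat.add_sub_cancel, pow_succ',
      mul_left_comm]

theorem natCast_mul_pow_mul_pow_sub_one {R : Type*} [CommSemiring R] (x : R) (m n : ℕ) :
    (n : R) * (x ^ m * x ^ (n - 1)) = n * x ^ (m + n - 1) := by
  cases n with
  | zero => simp
  | succ n => rw [← pow_add]; rfl

theorem poisson_tPow (j k j' k' : ℕ) :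
    pderiv 1 (tPow j k) * pderiv 0 (tPow j' k') - pderiv 0 (tPow j k) * pderiv 1 (tPow j' k') =
      ((k : ℂ) * j' - j * k') • tPow (j + j' - 1) (k + k' - 1) := by
  simp only [pderiv_one_tPow, pderiv_zero_tPow]
  simp only [tPow, MvPolynomial.smul_eq_C_mul, map_sub, map_mul, map_natCast]
  have left := natCast_mul_pow_mul_pow_sub_one (X 0 : A2) j j'
  have left' := natCast_mul_pow_mul_pow_sub_one (X 1 : A2) k' k
  have right := natCast_mul_pow_mul_pow_sub_one (X 0 : A2) j' j
  have right' := natCast_mul_pow_mul_pow_sub_one (X 1 : A2) k k'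
  rw [add_comm k'] at left'
  rw [add_comm j'] at right
  linear_combination ((k : A2) * X 1 ^ (k - 1) * X 1 ^ k') * left +
    ((j' : A2) * X 0 ^ (j + j' - 1)) * left' - ((k' : A2) * X 1 ^ k * X 1 ^ (k' - 1)) * right -
    ((j : A2) * X 0 ^ (j + j' - 1)) * right'

theorem lie_hamS_tPow (j k j' k' : ℕ) : ⁅hamS (tPow j k), hamS (tPow j' k')⁆ =
    ((k : ℂ) * j' - j * k') • hamS (tPow (j + j' - 1) (k + k' - 1)) := by
  rw [lie_hamS, poisson_tPow, map_smul]

theorem lie_partialS_zero_hamS_tPow (j k : ℕ) :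
    ⁅partialS 0, hamS (tPow j k)⁆ = (j : ℂ) • hamS (tPow (j - 1) k) := by
  rw [lie_partialS_hamS, pderiv_zero_tPow, map_smul]

theorem lie_partialS_one_hamS_tPow (j k : ℕ) :
    ⁅partialS 1, hamS (tPow j k)⁆ = (k : ℂ) • hamS (tPow j (k - 1)) := by
  rw [lie_partialS_hamS, pderiv_one_tPow, map_smul]

theorem lie_eulerS_zero_hamS_tPow (j k : ℕ) :
    ⁅eulerS 0, hamS (tPow j k)⁆ = ((j : ℂ) - 1) • hamS (tPow j k) := by
  rw [lie_eulerS_hamS, X_zero_mul_pderiv_tPow, map_sub, map_smul, sub_smul, one_smul]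

theorem lie_eulerS_one_hamS_tPow (j k : ℕ) :
    ⁅eulerS 1, hamS (tPow j k)⁆ = ((k : ℂ) - 1) • hamS (tPow j k) := by
  rw [lie_eulerS_hamS, X_one_mul_pderiv_tPow, map_sub, map_smul, sub_smul, one_smul]

theorem genL_eq_hamS (j k : ℕ) : genL ((j : ℤ) - 1, (k : ℤ) - 1) = hamS (tPow j k) := by
  have toNat_sub_one : ∀ n : ℕ, ((n : ℤ) - 1).toNat = n - 1 := fun n => by omega
  rw [genL, dif_pos (by simp only; omega)]
  refine Subtype.ext (W2_ext ?_ ?_)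
  · change derivationL _ (X 0) = hamiltonian _ (X 0)
    rw [hamiltonian_X_zero, pderiv_one_tPow]
    simp [derivationL, pderiv_X, toNat_sub_one, tPow]
  · change derivationL _ (X 1) = hamiltonian _ (X 1)
    rw [hamiltonian_X_one, pderiv_zero_tPow]
    simp [derivationL, pderiv_X, toNat_sub_one, tPow]

theorem hamS_tPow_zero_zero : hamS (tPow 0 0) = 0 :=
  Subtype.ext (W2_ext (by simp [hamS, hamiltonian_apply, tPow])
    (by simp [hamS, hamiltonian_apply, tPow]))

theorem hamS_tPow_zero_one : hamS (tPow 0 1) = partialS 0 :=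
  Subtype.ext (W2_ext (by simp [hamS, hamiltonian_apply, tPow, partialS, pderiv_X])
    (by simp [hamS, hamiltonian_apply, tPow, partialS, pderiv_X]))

theorem hamS_tPow_one_zero : hamS (tPow 1 0) = -partialS 1 :=
  Subtype.ext (W2_ext (by simp [hamS, hamiltonian_apply, tPow, partialS, pderiv_X])
    (by simp [hamS, hamiltonian_apply, tPow, partialS, pderiv_X]))

theorem hamS_tPow_one_one : hamS (tPow 1 1) = eulerS 0 - eulerS 1 :=
  Subtype.ext (W2_ext (by simp [hamS, hamiltonian_apply, tPow, eulerS, pderiv_X])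
    (by simp [hamS, hamiltonian_apply, tPow, eulerS, pderiv_X]))

end Monomials

section Localization

/-- The localization map `U(S̄₂) → U₍₋₁₎` as a homomorphism of algebras. -/
def locHom : U →ₐ[ℂ] ULoc :=
  { (OreLocalization.numeratorRingHom : U →+* ULoc) with commutes' := fun _ => rfl }

/-- `toULoc` as a linear map. -/
def toULocLinear : SBar →ₗ[ℂ] ULoc :=
  let _ : LieRing U := LieRing.ofAssociativeRing
  locHom.toLinearMap ∘ₗ (UniversalEnvelopingAlgebra.ι ℂ : SBar →ₗ⁅ℂ⁆ U).toLinearMap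

theorem toULoc_zero : toULoc 0 = 0 := map_zero toULocLinear

theorem toULoc_add (D E : SBar) : toULoc (D + E) = toULoc D + toULoc E := map_add toULocLinear D E

theorem toULoc_neg (D : SBar) : toULoc (-D) = -toULoc D := map_neg toULocLinear D

theorem toULoc_sub (D E : SBar) : toULoc (D - E) = toULoc D - toULoc E := map_sub toULocLinear D E

theorem toULoc_smul (c : ℂ) (D : SBar) : toULoc (c • D) = c • toULoc D := map_smul toULocLinear c D

theorem toULoc_lie (D E : SBar) :
    toULoc ⁅D, E⁆ = toULoc D * toULoc E - toULoc E * toULoc D := by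
  change locHom (toU ⁅D, E⁆) = locHom (toU D) * locHom (toU E) - locHom (toU E) * locHom (toU D)
  rw [toU_lie, map_sub, map_mul, map_mul]

theorem commute_toULoc {D E : SBar} (h : ⁅D, E⁆ = 0) : Commute (toULoc D) (toULoc E) := by
  rw [Commute, SemiconjBy, ← sub_eq_zero, ← toULoc_lie, h, toULoc_zero]

theorem toULoc_mul_of_lie_eq_smul {D E E' : SBar} {c : ℂ} (h : ⁅D, E⁆ = c • E') :
    toULoc D * toULoc E = toULoc E * toULoc D + c • toULoc E' := by
  rw [← toULoc_smul, ← h, toULoc_lie, add_sub_cancel]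

theorem lie_partialS (i j : Fin 2) : ⁅partialS i, partialS j⁆ = 0 :=
  Subtype.ext (Derivation.ext fun f => by
    change ⁅(pderiv i : W2), (pderiv j : W2)⁆ f = 0
    rw [Derivation.commutator_apply, pderiv_comm, sub_self])

theorem commute_partialUnit (i j : Fin 2) : Commute (partialUnit i : ULoc) (partialUnit j) :=
  commute_toULoc (lie_partialS i j)

theorem commute_dLoc (i j : Fin 2) : Commute (dLoc i) (dLoc j) := commute_toULoc (lie_eulerS i j)

theorem commute_partialUnit_dLoc {i j : Fin 2} (h : i ≠ j) :
    Commute (partialUnit i : ULoc) (dLoc j) :=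
  commute_toULoc (by rw [lie_partialS_eulerS, if_neg h])

theorem semiconjBy_partialUnit_dLoc (i : Fin 2) :
    SemiconjBy (partialUnit i : ULoc) (dLoc i) (dLoc i + 1) := by
  have lie_eq : ⁅partialS i, eulerS i⁆ = (1 : ℂ) • partialS i := by
    rw [lie_partialS_eulerS, if_pos rfl, one_smul]
  rw [SemiconjBy, add_one_mul]
  exact (toULoc_mul_of_lie_eq_smul lie_eq).trans (by rw [one_smul]; rfl)

/-- The coordinate `tᵢ`, which in `U₍₋₁₎` is represented by `dᵢ ∂ᵢ⁻¹`. -/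
def coordLoc (i : Fin 2) : ULoc := dLoc i * ((partialUnit i)⁻¹ : ULocˣ)

theorem coordLoc_mul_partialUnit (i : Fin 2) : coordLoc i * partialUnit i = dLoc i := by
  rw [coordLoc, Units.inv_mul_cancel_right]

theorem partialUnit_mul_coordLoc (i : Fin 2) :
    (partialUnit i : ULoc) * coordLoc i = coordLoc i * partialUnit i + 1 :=
  mul_mul_inv_eq_add_one (semiconjBy_partialUnit_dLoc i)

theorem commute_partialUnit_coordLoc {i j : Fin 2} (h : i ≠ j) :
    Commute (partialUnit i : ULoc) (coordLoc j) :=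
  (commute_partialUnit_dLoc h).mul_right (commute_partialUnit i j).units_inv_right

theorem commute_dLoc_coordLoc {i j : Fin 2} (h : i ≠ j) : Commute (dLoc i) (coordLoc j) :=
  (commute_dLoc i j).mul_right (commute_partialUnit_dLoc h.symm).symm.units_inv_right

theorem semiconjBy_coordLoc_dLoc (i : Fin 2) : SemiconjBy (coordLoc i) (dLoc i + 1) (dLoc i) :=
  SemiconjBy.mul_left (Commute.refl (dLoc i)) (semiconjBy_partialUnit_dLoc i).units_inv_symm_left

theorem partialPow_zero : partialPow 0 = 1 := by simp [partialPow]

theorem partialPow_natCast (a b : ℕ) :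
    partialPow (a, b) = (partialUnit 0 : ULoc) ^ a * (partialUnit 1 : ULoc) ^ b := by
  rw [partialPow, Units.val_mul, zpow_natCast, zpow_natCast, Units.val_pow_eq_pow_val,
    Units.val_pow_eq_pow_val]

theorem partialPow_add (β γ : ℤ × ℤ) : partialPow (β + γ) = partialPow β * partialPow γ := by
  have commute := (commute_partialUnit 0 1).units_of_val.zpow_zpow γ.1 β.2
  rw [partialPow, partialPow, partialPow, ← Units.val_mul, Prod.fst_add, Prod.snd_add, zpow_add,
    zpow_add, commute.mul_mul_mul_comm]

end Localization

section WeylAlgebra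

/-- The subalgebra of `U₍₋₁₎` generated by `∂₁^{±1}`, `∂₂^{±1}`, `d₁` and `d₂`: the second Weyl
algebra, localized at the powers of `∂₁` and `∂₂`. -/
def weylLoc : Subalgebra ℂ ULoc :=
  localizedWeyl ℂ (dLoc 0) (partialUnit 0) ⊔ localizedWeyl ℂ (dLoc 1) (partialUnit 1)

theorem localizedWeyl_le_weylLoc (i : Fin 2) :
    localizedWeyl ℂ (dLoc i) (partialUnit i) ≤ weylLoc := by
  fin_cases i
  exacts [le_sup_left, le_sup_right]

theorem dLoc_mem_weylLoc (i : Fin 2) : dLoc i ∈ weylLoc :=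
  localizedWeyl_le_weylLoc i (Algebra.subset_adjoin (by simp))

theorem partialUnit_zpow_mem_weylLoc (i : Fin 2) (n : ℤ) :
    ((partialUnit i ^ n : ULocˣ) : ULoc) ∈ weylLoc := by
  have mem : (partialUnit i : ULoc) ∈ weylLoc ∧ (((partialUnit i)⁻¹ : ULocˣ) : ULoc) ∈ weylLoc :=
    ⟨localizedWeyl_le_weylLoc i (Algebra.subset_adjoin (by simp)),
      localizedWeyl_le_weylLoc i (Algebra.subset_adjoin (by simp))⟩
  cases n with
  | ofNat n =>
    rw [Int.ofNat_eq_natCast, zpow_natCast, Units.val_pow_eq_pow_val]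
    exact pow_mem mem.1 n
  | negSucc n =>
    rw [zpow_negSucc, ← inv_pow, Units.val_pow_eq_pow_val]
    exact pow_mem mem.2 _

theorem partialPow_mem_weylLoc (β : ℤ × ℤ) : partialPow β ∈ weylLoc := by
  rw [partialPow, Units.val_mul]
  exact mul_mem (partialUnit_zpow_mem_weylLoc 0 β.1) (partialUnit_zpow_mem_weylLoc 1 β.2)

theorem coordLoc_mem_weylLoc (i : Fin 2) : coordLoc i ∈ weylLoc :=
  mul_mem (dLoc_mem_weylLoc i) (by simpa using partialUnit_zpow_mem_weylLoc i (-1))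

theorem commute_of_mem_weylLoc {u c : ULoc} (hp : ∀ i, Commute u (partialUnit i))
    (hd : ∀ i, Commute u (dLoc i)) (hc : c ∈ weylLoc) : Commute u c := by
  have le_centralizer : weylLoc ≤ Subalgebra.centralizer ℂ {u} :=
    sup_le
      (fun _ hv _ hw => hw ▸ commute_of_mem_localizedWeyl (hp 0) (hd 0) hv)
      (fun _ hv _ hw => hw ▸ commute_of_mem_localizedWeyl (hp 1) (hd 1) hv)
  exact le_centralizer hc u rfl

theorem toSubmodule_weylLoc_le_mul : weylLoc.toSubmodule ≤
    (localizedWeyl ℂ (dLoc 0) (partialUnit 0)).toSubmodule *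
      (localizedWeyl ℂ (dLoc 1) (partialUnit 1)).toSubmodule :=
  toSubmodule_sup_le_mul_of_commute fun _ ha _ hb => commute_of_mem_localizedWeyl
    (commute_of_mem_localizedWeyl (commute_partialUnit 1 0)
      (commute_partialUnit_dLoc one_ne_zero) ha).symm
    (commute_of_mem_localizedWeyl (commute_partialUnit_dLoc zero_ne_one).symm
      (commute_dLoc 1 0) ha).symm hb

theorem mem_H_iff {u : ULoc} :
    u ∈ H ↔ (∀ i, Commute u (partialUnit i)) ∧ ∀ i, Commute u (dLoc i) := by
  rw [H, Subalgebra.mem_centralizer_iff, Fin.forall_fin_two, Fin.forall_fin_two]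
  simp only [Set.forall_mem_insert, Set.mem_singleton_iff, forall_eq]
  exact ⟨fun ⟨hp, hq, hd, he⟩ => ⟨⟨hp.symm, hq.symm⟩, hd.symm, he.symm⟩,
    fun ⟨⟨hp, hq⟩, hd, he⟩ => ⟨hp.eq.symm, hq.eq.symm, hd.eq.symm, he.eq.symm⟩⟩

end WeylAlgebra

section HamiltonianGenerators

theorem exists_eq_partialPow_mul_locHom (u : ULoc) : ∃ β r, u = partialPow β * locHom r := by
  induction u using OreLocalization.ind with
  | _ r s =>
    obtain ⟨_, i, j, rfl⟩ := s
    set s : partialMonoid := ⟨toU (partialS 0) ^ i * toU (partialS 1) ^ j, i, j, rfl⟩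
    have partialPow_eq : partialPow (i, j) = OreLocalization.oreDiv (s : U) 1 := by
      change _ = locHom (toU (partialS 0) ^ i * toU (partialS 1) ^ j)
      rw [partialPow_natCast, map_mul, map_pow, map_pow]
      rfl
    have partialPow_mul : partialPow (i, j) * OreLocalization.oreDiv r s = locHom r := by
      rw [partialPow_eq, OreLocalization.mul_cancel]
      rfl
    refine ⟨(-i, -j), r, ?_⟩
    rw [← partialPow_mul, ← mul_assoc, ← partialPow_add, ← Prod.neg_mk, neg_add_cancel,
      partialPow_zero, one_mul]

theorem locHom_mem {N : Subalgebra ℂ ULoc} (h : ∀ D, toULoc D ∈ N) (u : U) : locHom u ∈ N := by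
  obtain ⟨w, rfl⟩ : ∃ w, UniversalEnvelopingAlgebra.mkAlgHom ℂ SBar w = u :=
    RingCon.mkₐ_surjective _ u
  induction w using TensorAlgebra.induction with
  | algebraMap r =>
    rw [AlgHom.commutes, AlgHom.commutes]
    exact N.algebraMap_mem r
  | ι D => exact h D
  | mul a b ha hb => rw [map_mul, map_mul]; exact mul_mem ha hb
  | add a b ha hb => rw [map_add, map_add]; exact add_mem ha hb

theorem eq_top_of_weylLoc_le {N : Subalgebra ℂ ULoc} (hN : weylLoc ≤ N)
    (hL : ∀ j k, toULoc (hamS (tPow j k)) ∈ N) : N = ⊤ := by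
  have hamS_mem : ∀ f, toULoc (hamS f) ∈ N := fun f => by
    induction f using MvPolynomial.induction_on' with
    | monomial s a =>
      rw [monomial_eq_smul_tPow, map_smul, toULoc_smul]
      exact N.smul_mem (hL _ _) a
    | add f g hf hg =>
      rw [map_add, toULoc_add]
      exact add_mem hf hg
  have toULoc_mem : ∀ D, toULoc D ∈ N := fun D => by
    obtain ⟨c, f, rfl⟩ := exists_eq_smul_eulerS_add_hamS D
    rw [toULoc_add, toULoc_smul]
    exact add_mem (N.smul_mem (hN (dLoc_mem_weylLoc 1)) c) (hamS_mem f)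
  refine eq_top_iff.2 fun u _ => ?_
  obtain ⟨β, r, rfl⟩ := exists_eq_partialPow_mul_locHom u
  exact mul_mem (hN (partialPow_mem_weylLoc β)) (locHom_mem toULoc_mem r)

/-- The image in `U₍₋₁₎` of the Hamiltonian vector field of `t₁ʲ t₂ᵏ`, which is `L_α` for
`α = (j - 1, k - 1)`. -/
def locL (j k : ℕ) : ULoc := toULoc (hamS (tPow j k))

theorem toULoc_genL (j k : ℕ) : toULoc (genL ((j : ℤ) - 1, (k : ℤ) - 1)) = locL j k := by
  rw [genL_eq_hamS, locL]

theorem locL_zero_zero : locL 0 0 = 0 := by rw [locL, hamS_tPow_zero_zero, toULoc_zero]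

theorem locL_zero_one : locL 0 1 = partialUnit 0 := by rw [locL, hamS_tPow_zero_one]; rfl

theorem locL_one_zero : locL 1 0 = -partialUnit 1 := by
  rw [locL, hamS_tPow_one_zero, toULoc_neg]; rfl

theorem locL_one_one : locL 1 1 = dLoc 0 - dLoc 1 := by
  rw [locL, hamS_tPow_one_one, toULoc_sub]; rfl

theorem locL_mul_sub_mul (j k j' k' : ℕ) : locL j k * locL j' k' - locL j' k' * locL j k =
    ((k : ℂ) * j' - j * k') • locL (j + j' - 1) (k + k' - 1) := by
  rw [locL, locL, ← toULoc_lie, lie_hamS_tPow, toULoc_smul, locL]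

theorem partialUnit_zero_mul_locL (j k : ℕ) :
    (partialUnit 0 : ULoc) * locL j k = locL j k * partialUnit 0 + j • locL (j - 1) k := by
  rw [← Nat.cast_smul_eq_nsmul ℂ]
  exact toULoc_mul_of_lie_eq_smul (lie_partialS_zero_hamS_tPow j k)

theorem partialUnit_one_mul_locL (j k : ℕ) :
    (partialUnit 1 : ULoc) * locL j k = locL j k * partialUnit 1 + k • locL j (k - 1) := by
  rw [← Nat.cast_smul_eq_nsmul ℂ]
  exact toULoc_mul_of_lie_eq_smul (lie_partialS_one_hamS_tPow j k)

theorem semiconjBy_locL_dLoc_zero (j k : ℕ) :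
    SemiconjBy (locL j k) (dLoc 0 + (j - 1 : ℤ)) (dLoc 0) := by
  have := toULoc_mul_of_lie_eq_smul (lie_eulerS_zero_hamS_tPow j k)
  rw [SemiconjBy, mul_add, ← zsmul_eq_mul', ← Int.cast_smul_eq_zsmul ℂ]
  simpa [dLoc, locL] using this.symm

theorem semiconjBy_locL_dLoc_one (j k : ℕ) :
    SemiconjBy (locL j k) (dLoc 1 + (k - 1 : ℤ)) (dLoc 1) := by
  have := toULoc_mul_of_lie_eq_smul (lie_eulerS_one_hamS_tPow j k)
  rw [SemiconjBy, mul_add, ← zsmul_eq_mul', ← Int.cast_smul_eq_zsmul ℂ]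
  simpa [dLoc, locL] using this.symm

end HamiltonianGenerators

section ShiftedGenerators

/-- The Hamiltonian generator `L_α` for `α = (m - 1, n - 1)` recentred at the point `(t₁, t₂)`: the
umbral expansion of `(X - t₁)ᵐ (Y - t₂)ⁿ` with `Xʲ Yᵏ` replaced by `locL j k`. -/
def shiftedL (m n : ℕ) : ULoc :=
  binomialTransform (coordLoc 1) (fun k => binomialTransform (coordLoc 0) (fun j => locL j k) m) n

theorem locL_eq_binomialTransform_shiftedL (m n : ℕ) :
    locL m n = binomialTransform (-coordLoc 0)
      (fun j => binomialTransform (-coordLoc 1) (shiftedL j) n) m := by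
  have (j : ℕ) : binomialTransform (-coordLoc 1) (shiftedL j) n =
      binomialTransform (coordLoc 0) (fun i => locL i n) j :=
    binomialTransform_neg_binomialTransform n
  simp only [this, binomialTransform_neg_binomialTransform]

theorem commute_partialUnit_shiftedL (i : Fin 2) (m n : ℕ) :
    Commute (partialUnit i : ULoc) (shiftedL m n) := by
  fin_cases i
  · exact commute_binomialTransform (commute_partialUnit_coordLoc zero_ne_one)
      (fun k => commute_binomialTransform_of_mul_eq (partialUnit_mul_coordLoc 0)
        (fun j => partialUnit_zero_mul_locL j k) m) n
  · exact commute_binomialTransform_of_mul_eq (partialUnit_mul_coordLoc 1)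
      (fun k => mul_binomialTransform (commute_partialUnit_coordLoc one_ne_zero)
        (fun j => partialUnit_one_mul_locL j k) m) n

theorem semiconjBy_shiftedL_dLoc_zero (m n : ℕ) :
    SemiconjBy (shiftedL m n) (dLoc 0 + (m - 1 : ℤ)) (dLoc 0) := by
  have recentred_zero (k : ℕ) := semiconjBy_binomialTransform (c := -1) (ε := 1)
    (by simpa using semiconjBy_coordLoc_dLoc 0) (ℓ := fun j => locL j k)
    (fun j => by simpa [sub_eq_neg_add] using semiconjBy_locL_dLoc_zero j k) m
  have recentred_one := semiconjBy_binomialTransform (x := coordLoc 1) (d := dLoc 0) (ε := 0)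
    (by rw [Int.cast_zero, add_zero]; exact (commute_dLoc_coordLoc zero_ne_one).symm)
    (fun k => by rw [mul_zero, add_zero]; exact recentred_zero k) n
  rwa [mul_zero, add_zero, mul_one, ← sub_eq_neg_add] at recentred_one

theorem semiconjBy_shiftedL_dLoc_one (m n : ℕ) :
    SemiconjBy (shiftedL m n) (dLoc 1 + (n - 1 : ℤ)) (dLoc 1) := by
  have recentred_zero (k : ℕ) := semiconjBy_binomialTransform (c := k - 1) (ε := 0)
    (by rw [Int.cast_zero, add_zero]; exact (commute_dLoc_coordLoc one_ne_zero).symm)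
    (ℓ := fun j => locL j k)
    (fun j => by rw [mul_zero, add_zero]; exact semiconjBy_locL_dLoc_one j k) m
  have recentred_one := semiconjBy_binomialTransform (c := -1) (ε := 1)
    (by simpa using semiconjBy_coordLoc_dLoc 1)
    (fun k => by simpa [sub_eq_neg_add] using recentred_zero k) n
  rwa [mul_one, ← sub_eq_neg_add] at recentred_one

theorem shiftedL_mul_partialPow_mem_H (m n : ℕ) :
    shiftedL m n * partialPow ((m : ℤ) - 1, (n : ℤ) - 1) ∈ H := by
  have commute_unit (i j : Fin 2) (k : ℤ) :
      Commute (partialUnit i : ULoc) ((partialUnit j ^ k : ULocˣ) : ULoc) :=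
    (commute_partialUnit i j).units_zpow_right k
  have commute_euler {i j : Fin 2} (h : i ≠ j) (k : ℤ) :
      SemiconjBy ((partialUnit i ^ k : ULocˣ) : ULoc) (dLoc j) (dLoc j) :=
    ((commute_partialUnit_dLoc h).symm.units_zpow_right k).symm
  refine mem_H_iff.2 ⟨fun i => ?_, fun i => ?_⟩
  · exact ((commute_partialUnit_shiftedL i m n).mul_right
      (by rw [partialPow, Units.val_mul]
          exact (commute_unit i 0 _).mul_right (commute_unit i 1 _))).symm
  · rw [partialPow, Units.val_mul]
    fin_cases i
    · exact (semiconjBy_shiftedL_dLoc_zero m n).mul_left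
        ((semiconjBy_zpow_add_intCast (semiconjBy_partialUnit_dLoc 0) _).mul_left
          (commute_euler one_ne_zero _))
    · exact (semiconjBy_shiftedL_dLoc_one m n).mul_left
        (((commute_euler zero_ne_one _).add_right (Int.commute_cast _ _)).mul_left
          (semiconjBy_zpow_add_intCast (semiconjBy_partialUnit_dLoc 1) _))

end ShiftedGenerators

section ShiftProd

theorem shiftProd_of_lt {lo hi : ℤ} (h : hi < lo) (x : ULoc) : shiftProd x lo hi = 1 := by
  rw [shiftProd, Int.toNat_of_nonpos (by omega), List.range_zero, List.map_nil, List.prod_nil]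

theorem shiftProd_eq_mul {lo hi : ℤ} (h : lo ≤ hi) (x : ULoc) :
    shiftProd x lo hi = (x - lo) * shiftProd x (lo + 1) hi := by
  have length_eq : (hi + 1 - lo).toNat = (hi + 1 - (lo + 1)).toNat + 1 := by omega
  rw [shiftProd, shiftProd, length_eq, List.range_succ_eq_map, List.map_cons, List.prod_cons,
    List.map_map, Nat.cast_zero, add_zero]
  congr 3
  funext k
  rw [Function.comp_apply, Nat.cast_succ, add_right_comm, add_assoc]

theorem commute_shiftProd {a x : ULoc} (h : Commute a x) (lo hi : ℤ) :
    Commute a (shiftProd x lo hi) := by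
  refine Commute.list_prod_right _ _ fun b hb => ?_
  obtain ⟨k, -, rfl⟩ := List.mem_map.1 hb
  exact h.sub_right (Int.commute_cast _ _)

theorem semiconjBy_shiftProd {p x : ULoc} (h : SemiconjBy p x (x + 1)) (lo hi : ℤ) :
    SemiconjBy p (shiftProd x lo hi) (shiftProd x (lo - 1) (hi - 1)) := by
  have length_eq : hi - 1 + 1 - (lo - 1) = hi + 1 - lo := by ring
  rw [shiftProd, shiftProd, length_eq]
  induction List.range (hi + 1 - lo).toNat with
  | nil => exact SemiconjBy.one_right p
  | cons k l ih =>
    have factor := h.sub_right (Int.commute_cast p (lo + k))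
    rw [List.map_cons, List.map_cons, List.prod_cons, List.prod_cons]
    refine SemiconjBy.mul_right ?_ ih
    rwa [sub_add_eq_add_sub, Int.cast_sub (lo + k), Int.cast_one, sub_sub_eq_add_sub]

theorem coordLoc_pow_mul_partialUnit_pow (i : Fin 2) (n : ℕ) :
    coordLoc i ^ n * (partialUnit i : ULoc) ^ n = shiftProd (dLoc i) 0 (n - 1) := by
  induction n with
  | zero => rw [pow_zero, pow_zero, mul_one, shiftProd_of_lt (by simp)]
  | succ n ih =>
    have shift : (partialUnit i : ULoc) * shiftProd (dLoc i) 1 n =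
        shiftProd (dLoc i) 0 (n - 1) * partialUnit i :=
      semiconjBy_shiftProd (semiconjBy_partialUnit_dLoc i) 1 n
    rw [pow_succ', pow_succ, mul_assoc, ← mul_assoc (coordLoc i ^ n), ih, ← shift, ← mul_assoc,
      coordLoc_mul_partialUnit, Nat.cast_succ, add_sub_cancel_right,
      shiftProd_eq_mul (Int.natCast_nonneg n), Int.cast_zero, sub_zero, zero_add]

end ShiftProd

section ExplicitFormula

/-- The summand of index `β` in the definition of `Y_α`, for arbitrary `β`. -/
def yTerm (α β : ℤ × ℤ) : ULoc :=
  ((-1 : ℂ) ^ ((α.1 + α.2) - (β.1 + β.2)) * (binom α β : ℂ)) •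
    (toULoc (genL β) * shiftProd (dLoc 0) 0 (α.1 - β.1 - 1) *
      shiftProd (dLoc 1) 0 (α.2 - β.2 - 1) * partialPow β)

theorem neg_coordLoc_pow_mul_partialPow (i j : ℕ × ℕ) :
    (-coordLoc 0) ^ i.2 * (-coordLoc 1) ^ j.2 *
        partialPow (((i.1 + i.2 : ℕ) : ℤ) - 1, ((j.1 + j.2 : ℕ) : ℤ) - 1) =
      (-1 : ℂ) ^ (i.2 + j.2) • (shiftProd (dLoc 0) 0 (i.2 - 1) * shiftProd (dLoc 1) 0 (j.2 - 1) *
        partialPow ((i.1 : ℤ) - 1, (j.1 : ℤ) - 1)) := by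
  have partialPow_eq : partialPow (((i.1 + i.2 : ℕ) : ℤ) - 1, ((j.1 + j.2 : ℕ) : ℤ) - 1) =
      (partialUnit 0 : ULoc) ^ i.2 * (partialUnit 1 : ULoc) ^ j.2 *
        partialPow ((i.1 : ℤ) - 1, (j.1 : ℤ) - 1) := by
    rw [← partialPow_natCast, ← partialPow_add, Prod.mk_add_mk, add_sub_assoc', add_sub_assoc',
      Nat.cast_add, Nat.cast_add, add_comm (i.1 : ℤ), add_comm (j.1 : ℤ)]
  have commute : Commute (coordLoc 1 ^ j.2) ((partialUnit 0 : ULoc) ^ i.2) :=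
    ((commute_partialUnit_coordLoc zero_ne_one).pow_pow _ _).symm
  have neg_pow_eq (x : ULoc) (a : ℕ) : (-x) ^ a = (-1 : ℂ) ^ a • x ^ a := by
    rw [← smul_pow, neg_one_smul]
  rw [partialPow_eq, ← coordLoc_pow_mul_partialUnit_pow, ← coordLoc_pow_mul_partialUnit_pow,
    neg_pow_eq, neg_pow_eq, smul_mul_smul_comm, smul_mul_assoc, pow_add, ← mul_assoc,
    commute.mul_mul_mul_comm]

theorem shiftedL_mul_partialPow (m n : ℕ) :
    shiftedL m n * partialPow ((m : ℤ) - 1, (n : ℤ) - 1) =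
      ∑ ji ∈ antidiagonal n ×ˢ antidiagonal m,
        yTerm ((m : ℤ) - 1, (n : ℤ) - 1) ((ji.2.1 : ℤ) - 1, (ji.1.1 : ℤ) - 1) := by
  rw [shiftedL, binomialTransform, Finset.sum_product, Finset.sum_mul]
  refine Finset.sum_congr rfl fun j hj => ?_
  rw [binomialTransform, ← Nat.cast_smul_eq_nsmul ℂ, Finset.sum_mul, Finset.smul_sum,
    Finset.sum_mul]
  refine Finset.sum_congr rfl fun i hi => ?_
  obtain rfl := Finset.HasAntidiagonal.mem_antidiagonal.1 hi
  obtain rfl := Finset.HasAntidiagonal.mem_antidiagonal.1 hj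
  have sign : ((i.1 + i.2 : ℕ) : ℤ) - 1 + (((j.1 + j.2 : ℕ) : ℤ) - 1) -
      ((i.1 : ℤ) - 1 + ((j.1 : ℤ) - 1)) = (i.2 + j.2 : ℕ) := by push_cast; ring
  have diff (i : ℕ × ℕ) : ((i.1 + i.2 : ℕ) : ℤ) - 1 - ((i.1 : ℤ) - 1) - 1 = i.2 - 1 := by
    push_cast; ring
  rw [yTerm, binom, toULoc_genL, sign, diff, diff, zpow_natCast]
  simp only [sub_add_cancel, Int.toNat_natCast, ← Nat.cast_smul_eq_nsmul ℂ, smul_mul_assoc,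
    mul_assoc]
  rw [← mul_assoc (_ ^ _), neg_coordLoc_pow_mul_partialPow, mul_smul_comm, smul_smul, smul_smul]
  congr 1
  · push_cast; ring
  · simp only [mul_assoc]

theorem yTerm_eq_zero {m n : ℕ} {β : ℤ × ℤ} (h : (m : ℤ) - 1 < β.1 ∨ (n : ℤ) - 1 < β.2) :
    yTerm ((m : ℤ) - 1, (n : ℤ) - 1) β = 0 := by
  have : binom ((m : ℤ) - 1, (n : ℤ) - 1) β = 0 := by
    rw [binom, sub_add_cancel, sub_add_cancel, Int.toNat_natCast, Int.toNat_natCast, mul_eq_zero]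
    exact h.imp (fun h => Nat.choose_eq_zero_of_lt (by omega))
      fun h => Nat.choose_eq_zero_of_lt (by omega)
  rw [yTerm, this, Nat.cast_zero, mul_zero, zero_smul]

theorem sum_yTerm {m n : ℕ} {T : Finset (ℤ × ℤ)} (hT : ∀ β ∈ T, -1 ≤ β.1 ∧ -1 ≤ β.2)
    (hT' : ∀ j ≤ m, ∀ k ≤ n, ((j : ℤ) - 1, (k : ℤ) - 1) ∈ T) :
    ∑ β ∈ T, yTerm ((m : ℤ) - 1, (n : ℤ) - 1) β =
      shiftedL m n * partialPow ((m : ℤ) - 1, (n : ℤ) - 1) := by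
  rw [shiftedL_mul_partialPow]
  refine (Finset.sum_of_injOn (fun ji => ((ji.2.1 : ℤ) - 1, (ji.1.1 : ℤ) - 1)) ?_ ?_ ?_ ?_).symm
  · intro ji hji ji' hji' h
    simp only [Finset.mem_coe, Finset.mem_product, Finset.HasAntidiagonal.mem_antidiagonal]
      at hji hji'
    simp only [Prod.mk.injEq] at h
    ext <;> omega
  · intro ji hji
    obtain ⟨hj, hi⟩ := Finset.mem_product.1 hji
    exact hT' _ (fst_le hi) _ (fst_le hj)
  · intro β hβ hβ'
    have nonneg := hT β hβ
    refine yTerm_eq_zero ?_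
    by_contra! le
    refine hβ' ⟨(((β.2 + 1).toNat, n - (β.2 + 1).toNat), ((β.1 + 1).toNat, m - (β.1 + 1).toNat)),
      ?_, ?_⟩
    · simp only [Finset.mem_coe, Finset.mem_product, Finset.HasAntidiagonal.mem_antidiagonal]
      omega
    · ext <;> simp only <;> omega
  · intros
    rfl

theorem binom_zero {α : ℤ × ℤ} (h1 : -1 ≤ α.1) (h2 : -1 ≤ α.2) :
    (binom α 0 : ℂ) = ((α.1 : ℂ) + 1) * (α.2 + 1) := by
  obtain ⟨m, hm⟩ := Int.eq_ofNat_of_zero_le (neg_le_iff_add_nonneg.1 h1)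
  obtain ⟨n, hn⟩ := Int.eq_ofNat_of_zero_le (neg_le_iff_add_nonneg.1 h2)
  have : binom α 0 = m * n := by simp [binom, hm, hn]
  rw [this]
  exact_mod_cast congrArg₂ (fun a b : ℤ => (a : ℂ) * b) hm.symm hn.symm

theorem binom_zero_neg_one {α : ℤ × ℤ} (h1 : -1 ≤ α.1) :
    (binom α (0, -1) : ℂ) = (α.1 : ℂ) + 1 := by
  obtain ⟨m, hm⟩ := Int.eq_ofNat_of_zero_le (neg_le_iff_add_nonneg.1 h1)
  have : binom α (0, -1) = m := by simp [binom, hm]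
  rw [this]
  exact_mod_cast congrArg (fun a : ℤ => (a : ℂ)) hm.symm

theorem binom_neg_one_zero {α : ℤ × ℤ} (h2 : -1 ≤ α.2) :
    (binom α (-1, 0) : ℂ) = (α.2 : ℂ) + 1 := by
  obtain ⟨n, hn⟩ := Int.eq_ofNat_of_zero_le (neg_le_iff_add_nonneg.1 h2)
  have : binom α (-1, 0) = n := by simp [binom, hn]
  rw [this]
  exact_mod_cast congrArg (fun a : ℤ => (a : ℂ)) hn.symm

theorem yTerm_self {α : ℤ × ℤ} : yTerm α α = toULoc (genL α) * partialPow α := by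
  rw [yTerm, shiftProd_of_lt (by simp), shiftProd_of_lt (by simp)]
  simp [binom]

theorem yTerm_neg_one_neg_one (α : ℤ × ℤ) : yTerm α (-1, -1) = 0 := by
  have genL_eq : toULoc (genL (-1, -1)) = 0 := by
    simpa [locL_zero_zero] using toULoc_genL 0 0
  rw [yTerm, genL_eq, zero_mul, zero_mul, zero_mul, smul_zero]

theorem yTerm_zero_neg_one {α : ℤ × ℤ} (h1 : -1 ≤ α.1) :
    yTerm α (0, -1) = ((-1 : ℂ) ^ (α.1 + α.2) * (α.1 + 1)) •
      (shiftProd (dLoc 0) 0 (α.1 - 1) * shiftProd (dLoc 1) (-1) (α.2 - 1)) := by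
  have genL_eq : toULoc (genL (0, -1)) = -(partialUnit 1 : ULoc) := by
    simpa [locL_one_zero] using toULoc_genL 1 0
  have partialPow_eq : partialPow (0, -1) = ((partialUnit 1)⁻¹ : ULocˣ) := by simp [partialPow]
  have conj : (partialUnit 1 : ULoc) *
      (shiftProd (dLoc 0) 0 (α.1 - 1) * shiftProd (dLoc 1) 0 α.2) =
        shiftProd (dLoc 0) 0 (α.1 - 1) * shiftProd (dLoc 1) (-1) (α.2 - 1) * partialUnit 1 :=
    SemiconjBy.mul_right (commute_shiftProd (commute_partialUnit_dLoc one_ne_zero) _ _)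
      (semiconjBy_shiftProd (semiconjBy_partialUnit_dLoc 1) 0 α.2)
  rw [yTerm, genL_eq, partialPow_eq, binom_zero_neg_one h1]
  simp only [sub_zero, sub_neg_eq_add, add_sub_cancel_right, zero_add]
  rw [mul_assoc (-(partialUnit 1 : ULoc)), neg_mul, conj, neg_mul, Units.mul_inv_cancel_right,
    zpow_add_one₀ (by norm_num)]
  module

theorem yTerm_neg_one_zero {α : ℤ × ℤ} (h2 : -1 ≤ α.2) :
    yTerm α (-1, 0) = -((-1 : ℂ) ^ (α.1 + α.2) * (α.2 + 1)) •
      (shiftProd (dLoc 0) (-1) (α.1 - 1) * shiftProd (dLoc 1) 0 (α.2 - 1)) := by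
  have genL_eq : toULoc (genL (-1, 0)) = partialUnit 0 := by
    simpa [locL_zero_one] using toULoc_genL 0 1
  have partialPow_eq : partialPow (-1, 0) = ((partialUnit 0)⁻¹ : ULocˣ) := by simp [partialPow]
  have conj : (partialUnit 0 : ULoc) *
      (shiftProd (dLoc 0) 0 α.1 * shiftProd (dLoc 1) 0 (α.2 - 1)) =
        shiftProd (dLoc 0) (-1) (α.1 - 1) * shiftProd (dLoc 1) 0 (α.2 - 1) * partialUnit 0 :=
    SemiconjBy.mul_right (semiconjBy_shiftProd (semiconjBy_partialUnit_dLoc 0) 0 α.1)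
      (commute_shiftProd (commute_partialUnit_dLoc zero_ne_one) _ _)
  rw [yTerm, genL_eq, partialPow_eq, binom_neg_one_zero h2]
  simp only [sub_zero, sub_neg_eq_add, add_sub_cancel_right, add_zero]
  rw [mul_assoc (partialUnit 0 : ULoc), conj, Units.mul_inv_cancel_right,
    zpow_add_one₀ (by norm_num)]
  module

theorem dLoc_sub_mul_shiftProd {a b : ℤ} (ha : 0 ≤ a) (hb : 0 ≤ b) :
    (dLoc 0 - dLoc 1) * shiftProd (dLoc 0) 0 (a - 1) * shiftProd (dLoc 1) 0 (b - 1) =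
      shiftProd (dLoc 0) (-1) (a - 1) * shiftProd (dLoc 1) 0 (b - 1) -
        shiftProd (dLoc 0) 0 (a - 1) * shiftProd (dLoc 1) (-1) (b - 1) := by
  have commute : Commute (dLoc 1) (shiftProd (dLoc 0) 0 (a - 1)) :=
    commute_shiftProd (commute_dLoc 1 0) _ _
  rw [shiftProd_eq_mul (lo := -1) (by omega) (dLoc 0),
    shiftProd_eq_mul (lo := -1) (by omega) (dLoc 1), neg_add_cancel, sub_mul, commute.eq]
  simp only [Int.cast_neg, Int.cast_one]
  noncomm_ring

theorem yTerm_zero {α : ℤ × ℤ} (h1 : -1 ≤ α.1) (h2 : -1 ≤ α.2) :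
    yTerm α 0 = ((-1 : ℂ) ^ (α.1 + α.2) * ((α.1 + 1) * (α.2 + 1))) •
      (shiftProd (dLoc 0) (-1) (α.1 - 1) * shiftProd (dLoc 1) 0 (α.2 - 1) -
        shiftProd (dLoc 0) 0 (α.1 - 1) * shiftProd (dLoc 1) (-1) (α.2 - 1)) := by
  have genL_eq : toULoc (genL 0) = dLoc 0 - dLoc 1 := by
    have := toULoc_genL 1 1
    rw [locL_one_one, Nat.cast_one, sub_self] at this
    exact this
  rw [yTerm, genL_eq, partialPow_zero, binom_zero h1 h2]
  simp only [Prod.fst_zero, Prod.snd_zero, add_zero, sub_zero, mul_one]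
  rcases h1.eq_or_lt with h1 | h1
  · simp [← h1]
  rcases h2.eq_or_lt with h2 | h2
  · simp [← h2]
  · rw [dLoc_sub_mul_shiftProd (by omega) (by omega)]

theorem sum_yTerm_boundary {α : ℤ × ℤ} (h1 : -1 ≤ α.1) (h2 : -1 ≤ α.2) :
    ∑ β ∈ ({0, (0, -1), (-1, 0), (-1, -1)} : Finset (ℤ × ℤ)), yTerm α β =
      ((-1 : ℂ) ^ (α.1 + α.2) * ((α.1 * (α.2 + 1) : ℤ) : ℂ)) •
        (shiftProd (dLoc 0) (-1) (α.1 - 1) * shiftProd (dLoc 1) 0 (α.2 - 1)) +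
      ((-1 : ℂ) ^ (α.1 + α.2 - 1) * (((α.1 + 1) * α.2 : ℤ) : ℂ)) •
        (shiftProd (dLoc 0) 0 (α.1 - 1) * shiftProd (dLoc 1) (-1) (α.2 - 1)) := by
  rw [Finset.sum_insert (by decide), Finset.sum_insert (by decide), Finset.sum_insert (by decide),
    Finset.sum_singleton, yTerm_zero h1 h2, yTerm_zero_neg_one h1, yTerm_neg_one_zero h2,
    yTerm_neg_one_neg_one, zpow_sub_one₀ (by norm_num), inv_neg_one]
  push_cast
  module

end ExplicitFormula

section Index

/-- The exponent `α₁ + 1` of `t₁` in the Hamiltonian of `L_α`. -/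
def YIndex.fst (α : YIndex) : ℕ := (α.1.1 + 1).toNat

/-- The exponent `α₂ + 1` of `t₂` in the Hamiltonian of `L_α`. -/
def YIndex.snd (α : YIndex) : ℕ := (α.1.2 + 1).toNat

theorem YIndex.coe_fst_sub_one (α : YIndex) : (α.fst : ℤ) - 1 = α.1.1 := by
  have := α.2.1
  rw [YIndex.fst]
  omega

theorem YIndex.coe_snd_sub_one (α : YIndex) : (α.snd : ℤ) - 1 = α.1.2 := by
  have := α.2.2.1
  rw [YIndex.snd]
  omega

theorem Y_eq (α : YIndex) : Y α.1 = shiftedL α.fst α.snd * partialPow α.1 := by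
  obtain ⟨h1, h2, h3, h4⟩ := α.2
  have notMem : α.1 ∉ lowerSet α.1 ∪ {0, (0, -1), (-1, 0), (-1, -1)} := by
    simp only [Finset.mem_union, mem_lowerSet, Finset.mem_insert, Finset.mem_singleton,
      Prod.ext_iff]
    rintro (h | h | h | h | h)
    · exact h.2.2.2.1.false
    · exact h4 (Prod.ext h.1 h.2)
    all_goals omega
  have disjoint : Disjoint (lowerSet α.1) {0, (0, -1), (-1, 0), (-1, -1)} := by
    simp [Finset.disjoint_right, mem_lowerSet]
  have sum_eq := sum_yTerm (m := α.fst) (n := α.snd)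
    (T := insert α.1 (lowerSet α.1 ∪ {0, (0, -1), (-1, 0), (-1, -1)}))
    (fun β hβ => by
      simp only [Finset.mem_insert, Finset.mem_union, mem_lowerSet, Finset.mem_singleton,
        Prod.ext_iff, Prod.fst_zero, Prod.snd_zero] at hβ
      omega)
    (fun j hj k hk => by
      have := α.coe_fst_sub_one
      have := α.coe_snd_sub_one
      simp only [Finset.mem_insert, Finset.mem_union, mem_lowerSet, Finset.mem_singleton,
        Prod.ext_iff, Prod.fst_zero, Prod.snd_zero, ne_eq]
      omega)
  rw [α.coe_fst_sub_one, α.coe_snd_sub_one, Prod.mk.eta] at sum_eq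
  rw [← sum_eq, Finset.sum_insert notMem, Finset.sum_union disjoint, yTerm_self,
    sum_yTerm_boundary h1 h2, Y, ← add_assoc, ← add_assoc]
  rfl

end Index

section Filtration

/-- The degree `|α| + 1` of `Y_α`, which is positive. -/
def YIndex.deg (α : YIndex) : ℕ := α.fst + α.snd - 1

theorem YIndex.deg_add_one (α : YIndex) : α.deg + 1 = α.fst + α.snd := by
  have := α.coe_fst_sub_one
  have := α.coe_snd_sub_one
  have := α.2.2.2.1
  rw [YIndex.deg]
  omega

theorem YIndex.exists_fst_eq_snd_eq {j k : ℕ} (h : 2 ≤ j + k) (h1 : ¬(j = 1 ∧ k = 1)) :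
    ∃ α : YIndex, α.fst = j ∧ α.snd = k := by
  refine ⟨⟨((j : ℤ) - 1, (k : ℤ) - 1), by omega, by omega, by omega, fun h0 => h1 ?_⟩,
    by simp [YIndex.fst], by simp [YIndex.snd]⟩
  rw [Prod.ext_iff, Prod.fst_zero, Prod.snd_zero] at h0
  omega

theorem YIndex.ext_fst_snd {α β : YIndex} (h1 : α.fst = β.fst) (h2 : α.snd = β.snd) : α = β := by
  have := α.coe_fst_sub_one
  have := α.coe_snd_sub_one
  have := β.coe_fst_sub_one
  have := β.coe_snd_sub_one
  exact Subtype.ext (Prod.ext (by omega) (by omega))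

theorem Y_mem_H (α : YIndex) : Y α.1 ∈ H := by
  simpa only [Y_eq, α.coe_fst_sub_one, α.coe_snd_sub_one] using
    shiftedL_mul_partialPow_mem_H α.fst α.snd

theorem commute_of_mem_H_of_mem_weylLoc {u c : ULoc} (hu : u ∈ H) (hc : c ∈ weylLoc) :
    Commute u c :=
  commute_of_mem_weylLoc (mem_H_iff.1 hu).1 (mem_H_iff.1 hu).2 hc

theorem partialPow_mul_partialPow_neg (β : ℤ × ℤ) : partialPow β * partialPow (-β) = 1 := by
  rw [← partialPow_add, add_neg_cancel, partialPow_zero]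

theorem shiftedL_fst_snd (α : YIndex) : shiftedL α.fst α.snd = Y α.1 * partialPow (-α.1) := by
  rw [Y_eq, mul_assoc, partialPow_mul_partialPow_neg, mul_one]

theorem shiftedL_zero_zero : shiftedL 0 0 = 0 := by
  rw [shiftedL, binomialTransform_zero, binomialTransform_zero, locL_zero_zero]

theorem shiftedL_zero_one : shiftedL 0 1 = partialUnit 0 := by
  simp only [shiftedL, binomialTransform_succ, binomialTransform_zero, zero_add, locL_zero_zero,
    locL_zero_one, zero_mul, sub_zero]

theorem shiftedL_one_zero : shiftedL 1 0 = -partialUnit 1 := by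
  simp only [shiftedL, binomialTransform_succ, binomialTransform_zero, zero_add, locL_zero_zero,
    locL_one_zero, zero_mul, sub_zero]

theorem shiftedL_one_one : shiftedL 1 1 = 0 := by
  simp only [shiftedL, binomialTransform_succ, binomialTransform_zero, zero_add, locL_zero_zero,
    locL_one_zero, locL_zero_one, locL_one_one, zero_mul, sub_zero, neg_mul,
    partialUnit_mul_coordLoc, coordLoc_mul_partialUnit]
  abel

/-- The filtration of `U₍₋₁₎` in which `Y_α` has degree `YIndex.deg α` and the localized Weyl
algebra has degree `0`; the index `n` stands for degree less than `n`. -/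
abbrev yFiltration (n : ℕ) : Submodule ℂ ULoc :=
  wordFiltration weylLoc YIndex.deg (fun α => Y α.1) n

theorem commute_Y_of_mem_weylLoc (α : YIndex) : ∀ c ∈ weylLoc, Commute (Y α.1) c :=
  fun _ => commute_of_mem_H_of_mem_weylLoc (Y_mem_H α)

theorem mul_mem_yFiltration {m n k : ℕ} (hk : m + n ≤ k + 1) {u v : ULoc}
    (hu : u ∈ yFiltration m) (hv : v ∈ yFiltration n) : u * v ∈ yFiltration k :=
  mul_mem_wordFiltration commute_Y_of_mem_weylLoc hk hu hv

theorem mul_mem_yFiltration_of_mem_weylLoc {n : ℕ} {u : ULoc} (hu : u ∈ yFiltration n) {c : ULoc}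
    (hc : c ∈ weylLoc) : u * c ∈ yFiltration n :=
  mul_mem_yFiltration le_rfl hu (mem_wordFiltration_of_mem one_pos hc)

section Unitriangular

variable {N : Submodule ℂ ULoc} (hN : ∀ u ∈ N, ∀ c ∈ weylLoc, u * c ∈ N) {m n : ℕ}
include hN

theorem shiftedL_mem_of_Y_mem (h1 : 0 < m + n → 1 ∈ N)
    (hY : ∀ α : YIndex, α.fst = m → α.snd = n → Y α.1 ∈ N) : shiftedL m n ∈ N := by
  have partialUnit_mem (i : Fin 2) (h : 0 < m + n) : (partialUnit i : ULoc) ∈ N := by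
    simpa using hN 1 (h1 h) _ (partialUnit_zpow_mem_weylLoc i 1)
  by_cases h : 2 ≤ m + n ∧ ¬(m = 1 ∧ n = 1)
  · obtain ⟨α, rfl, rfl⟩ := YIndex.exists_fst_eq_snd_eq h.1 h.2
    exact shiftedL_fst_snd α ▸ hN _ (hY α rfl rfl) _ (partialPow_mem_weylLoc _)
  · obtain ⟨rfl, rfl⟩ | ⟨rfl, rfl⟩ | ⟨rfl, rfl⟩ | ⟨rfl, rfl⟩ :
      m = 0 ∧ n = 0 ∨ m = 0 ∧ n = 1 ∨ m = 1 ∧ n = 0 ∨ m = 1 ∧ n = 1 := by omega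
    · exact shiftedL_zero_zero ▸ zero_mem N
    · exact shiftedL_zero_one ▸ partialUnit_mem 0 one_pos
    · exact shiftedL_one_zero ▸ neg_mem (partialUnit_mem 1 one_pos)
    · exact shiftedL_one_one ▸ zero_mem N

theorem locL_mem_of_shiftedL_mem (h : ∀ j ≤ m, ∀ k ≤ n, shiftedL j k ∈ N) : locL m n ∈ N := by
  rw [locL_eq_binomialTransform_shiftedL]
  have pow_mem (i : Fin 2) (a : ℕ) : (- -coordLoc i) ^ a ∈ weylLoc :=
    pow_mem (neg_mem (neg_mem (coordLoc_mem_weylLoc i))) a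
  exact binomialTransform_mem fun j hj a => hN _
    (binomialTransform_mem fun k hk b => hN _ (h j hj k hk) _ (pow_mem 1 b)) _ (pow_mem 0 a)

theorem shiftedL_sub_locL_mem (h : ∀ j ≤ m, ∀ k ≤ n, j + k < m + n → locL j k ∈ N) :
    shiftedL m n - locL m n ∈ N := by
  have pow_mem (i : Fin 2) (a : ℕ) : (-coordLoc i) ^ a ∈ weylLoc :=
    pow_mem (neg_mem (coordLoc_mem_weylLoc i)) a
  have outer : shiftedL m n - binomialTransform (coordLoc 0) (fun j => locL j n) m ∈ N :=
    binomialTransform_sub_mem fun k hk b => hN _ (binomialTransform_mem fun j hj a =>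
      hN _ (h j hj k hk.le (by omega)) _ (pow_mem 0 a)) _ (pow_mem 1 b)
  have inner : binomialTransform (coordLoc 0) (fun j => locL j n) m - locL m n ∈ N :=
    binomialTransform_sub_mem fun j hj a =>
      hN _ (h j hj.le n le_rfl (by omega)) _ (pow_mem 0 a)
  exact sub_add_sub_cancel (shiftedL m n) _ (locL m n) ▸ add_mem outer inner

end Unitriangular

theorem shiftedL_mem_yFiltration (j k : ℕ) : shiftedL j k ∈ yFiltration (j + k) := by
  refine shiftedL_mem_of_Y_mem (fun _ hu _ hc => mul_mem_yFiltration_of_mem_weylLoc hu hc)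
    (fun h => mem_wordFiltration_of_mem h weylLoc.one_mem) ?_
  rintro α rfl rfl
  exact α.deg_add_one ▸ mem_wordFiltration_succ α

theorem locL_mem_yFiltration (j k : ℕ) : locL j k ∈ yFiltration (j + k) :=
  locL_mem_of_shiftedL_mem (fun _ hu _ hc => mul_mem_yFiltration_of_mem_weylLoc hu hc)
    fun j' hj k' hk => wordFiltration_mono (add_le_add hj hk) (shiftedL_mem_yFiltration j' k')

theorem locL_fst_snd_mem_yFiltration (α : YIndex) :
    locL α.fst α.snd ∈ yFiltration (α.deg + 1) :=
  α.deg_add_one ▸ locL_mem_yFiltration α.fst α.snd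

theorem shiftedL_fst_snd_mem_yFiltration (α : YIndex) :
    shiftedL α.fst α.snd ∈ yFiltration (α.deg + 1) :=
  α.deg_add_one ▸ shiftedL_mem_yFiltration α.fst α.snd

theorem shiftedL_sub_locL_mem_yFiltration (α : YIndex) :
    shiftedL α.fst α.snd - locL α.fst α.snd ∈ yFiltration α.deg :=
  shiftedL_sub_locL_mem (fun _ hu _ hc => mul_mem_yFiltration_of_mem_weylLoc hu hc)
    fun j _ k _ h => wordFiltration_mono (by have := α.deg_add_one; omega)
      (locL_mem_yFiltration j k)

theorem Y_sub_locL_mul_partialPow_mem_yFiltration (α : YIndex) :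
    Y α.1 - locL α.fst α.snd * partialPow α.1 ∈ yFiltration α.deg := by
  rw [Y_eq, ← sub_mul]
  exact mul_mem_yFiltration_of_mem_weylLoc (shiftedL_sub_locL_mem_yFiltration α)
    (partialPow_mem_weylLoc _)

theorem locL_mul_sub_mul_mem_yFiltration (α β : YIndex) :
    locL α.fst α.snd * locL β.fst β.snd - locL β.fst β.snd * locL α.fst α.snd ∈
      yFiltration (α.deg + β.deg) := by
  rw [locL_mul_sub_mul]
  by_cases h : α.fst + β.fst = 0 ∨ α.snd + β.snd = 0
  · have coeff_eq_zero : (α.snd * β.fst - α.fst * β.snd : ℂ) = 0 := by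
      obtain h | h := h <;> simp [Nat.add_eq_zero_iff.1 h]
    rw [coeff_eq_zero, zero_smul]
    exact zero_mem _
  · refine Submodule.smul_mem _ _ (wordFiltration_mono ?_ (locL_mem_yFiltration _ _))
    have := α.deg_add_one
    have := β.deg_add_one
    omega

theorem shiftedL_mul_sub_mul_mem_yFiltration (α β : YIndex) :
    shiftedL α.fst α.snd * shiftedL β.fst β.snd - shiftedL β.fst β.snd * shiftedL α.fst α.snd ∈
      yFiltration (α.deg + β.deg) := by
  have expand (x x' l l' : ULoc) : x * x' - x' * x =
      (l * l' - l' * l) + (l * (x' - l') - (x' - l') * l) +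
        ((x - l) * x' - x' * (x - l)) := by noncomm_ring
  rw [expand _ _ (locL α.fst α.snd) (locL β.fst β.snd)]
  have lower_α := shiftedL_sub_locL_mem_yFiltration α
  have lower_β := shiftedL_sub_locL_mem_yFiltration β
  have locL_mem := locL_fst_snd_mem_yFiltration α
  have shiftedL_mem := shiftedL_fst_snd_mem_yFiltration β
  refine add_mem (add_mem (locL_mul_sub_mul_mem_yFiltration α β) (sub_mem ?_ ?_)) (sub_mem ?_ ?_)
  exacts [mul_mem_yFiltration (by omega) locL_mem lower_β,
    mul_mem_yFiltration (by omega) lower_β locL_mem,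
    mul_mem_yFiltration (by omega) lower_α shiftedL_mem,
    mul_mem_yFiltration (by omega) shiftedL_mem lower_α]

theorem Y_mul_sub_mul_mem_yFiltration (α β : YIndex) :
    Y α.1 * Y β.1 - Y β.1 * Y α.1 ∈ yFiltration (α.deg + β.deg) := by
  have mul_eq (α β : YIndex) : Y α.1 * Y β.1 =
      shiftedL α.fst α.snd * shiftedL β.fst β.snd * partialPow (α.1 + β.1) := by
    have commute := (commute_Y_of_mem_weylLoc β _ (partialPow_mem_weylLoc (-α.1))).symm
    rw [shiftedL_fst_snd, shiftedL_fst_snd, commute.mul_mul_mul_comm, ← partialPow_add, mul_assoc,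
      ← partialPow_add, ← neg_add, neg_add_cancel, partialPow_zero, mul_one]
  rw [mul_eq, mul_eq, add_comm β.1, ← sub_mul]
  exact mul_mem_yFiltration_of_mem_weylLoc (shiftedL_mul_sub_mul_mem_yFiltration α β)
    (partialPow_mem_weylLoc _)

end Filtration

section Generation

theorem locL_mem_of_locL_mem {N : Subalgebra ℂ ULoc} (h10 : locL 1 0 ∈ N) (h21 : locL 2 1 ∈ N)
    (h02 : locL 0 2 ∈ N) (j k : ℕ) : locL j k ∈ N := by
  have lie_mem {j k j' k' : ℕ} (h : locL j k ∈ N) (h' : locL j' k' ∈ N)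
      (hc : (k * j' - j * k' : ℂ) ≠ 0) : locL (j + j' - 1) (k + k' - 1) ∈ N := by
    have smul_mem := sub_mem (mul_mem h h') (mul_mem h' h)
    rw [locL_mul_sub_mul] at smul_mem
    exact (N.toSubmodule.smul_mem_iff hc).1 smul_mem
  induction k generalizing j with
  | zero =>
    induction j with
    | zero => exact locL_zero_zero ▸ zero_mem N
    | succ j ih =>
      obtain rfl | hj := eq_or_ne j 0
      · exact h10
      · have := lie_mem h21 ih (by simpa using hj)
        rwa [show 2 + j - 1 = j + 1 by omega] at this
  | succ k ih =>
    have := lie_mem h02 (ih (j + 1)) (by simpa using Nat.cast_add_one_ne_zero j)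
    rwa [show 0 + (j + 1) - 1 = j by omega, show 2 + k - 1 = k + 1 by omega] at this

theorem toSubmodule_H_le {V : Submodule ℂ ULoc} (hV : V ≤ H.toSubmodule)
    (h : V * weylLoc.toSubmodule = ⊤) : H.toSubmodule ≤ V := by
  intro u hu
  obtain ⟨hp, hd⟩ := mem_H_iff.1 hu
  have mem : u ∈ (localizedWeyl ℂ (dLoc 0) (partialUnit 0)).toSubmodule *
      ((localizedWeyl ℂ (dLoc 1) (partialUnit 1)).toSubmodule * V) := by
    have comm := Submodule.mul_comm_of_commute (M := V) (N := weylLoc.toSubmodule)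
      fun v hv c hc => commute_of_mem_H_of_mem_weylLoc (hV hv) hc
    rw [← mul_assoc]
    exact mul_le_mul_left toSubmodule_weylLoc_le_mul V (comm ▸ h ▸ Submodule.mem_top)
  have commute_mul {a : ULoc} (ha : ∀ c ∈ localizedWeyl ℂ (dLoc 1) (partialUnit 1), Commute a c)
      (haV : ∀ v ∈ V, Commute a v) :
      ∀ v ∈ (localizedWeyl ℂ (dLoc 1) (partialUnit 1)).toSubmodule * V, Commute a v := fun v hv =>
    Submodule.mul_induction_on hv (fun c hc v hv => (ha c hc).mul_right (haV v hv))
      fun _ _ => Commute.add_right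
  have commute_partialUnit_V (i : Fin 2) : ∀ v ∈ V, Commute (partialUnit i : ULoc) v :=
    fun v hv => ((mem_H_iff.1 (hV hv)).1 i).symm
  have commute_dLoc_V (i : Fin 2) : ∀ v ∈ V, Commute (dLoc i) v :=
    fun v hv => ((mem_H_iff.1 (hV hv)).2 i).symm
  refine mem_of_mem_localizedWeyl_mul (semiconjBy_partialUnit_dLoc 1) (commute_partialUnit_V 1)
    (commute_dLoc_V 1) (hp 1).symm (hd 1).symm ?_
  refine mem_of_mem_localizedWeyl_mul (semiconjBy_partialUnit_dLoc 0)
    (commute_mul (fun c => ?_) (commute_partialUnit_V 0)) (commute_mul (fun c => ?_)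
      (commute_dLoc_V 0)) (hp 0).symm (hd 0).symm mem
  · exact commute_of_mem_localizedWeyl (commute_partialUnit 0 1)
      (commute_partialUnit_dLoc zero_ne_one)
  · exact commute_of_mem_localizedWeyl (commute_partialUnit_dLoc one_ne_zero).symm
      (commute_dLoc 0 1)

theorem toSubmodule_mul_weylLoc_eq_top {G : Subalgebra ℂ ULoc} (hG : G ≤ H)
    (h20 : Y (1, -1) ∈ G) (h02 : Y (-1, 1) ∈ G) (h21 : Y (1, 0) ∈ G) :
    G.toSubmodule * weylLoc.toSubmodule = ⊤ := by
  set N := G ⊔ weylLoc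
  have hN : ∀ u ∈ N.toSubmodule, ∀ c ∈ weylLoc, u * c ∈ N.toSubmodule :=
    fun u hu c hc => N.mul_mem hu (le_sup_right (a := G) hc)
  have Y_mem (α : YIndex) (h : α.fst ≤ 2 ∧ α.snd ≤ 1 ∨ α.fst = 0 ∧ α.snd ≤ 2) : Y α.1 ∈ N := by
    obtain h | h | h : α.1 = (1, -1) ∨ α.1 = (-1, 1) ∨ α.1 = (1, 0) := by
      have := α.coe_fst_sub_one
      have := α.coe_snd_sub_one
      have := α.2
      simp only [ne_eq, Prod.ext_iff, Prod.fst_zero, Prod.snd_zero] at this ⊢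
      omega
    all_goals exact le_sup_left (b := weylLoc) (by rwa [h])
  have shiftedL_mem (j k : ℕ) (h : j ≤ 2 ∧ k ≤ 1 ∨ j = 0 ∧ k ≤ 2) : shiftedL j k ∈ N :=
    shiftedL_mem_of_Y_mem hN (fun _ => N.one_mem)
      fun α hfst hsnd => Y_mem α (by rwa [hfst, hsnd])
  have sup_eq_top : N = ⊤ := eq_top_of_weylLoc_le le_sup_right <| locL_mem_of_locL_mem
    (locL_mem_of_shiftedL_mem hN fun j hj k hk => shiftedL_mem j k (by omega))
    (locL_mem_of_shiftedL_mem hN fun j hj k hk => shiftedL_mem j k (by omega))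
    (locL_mem_of_shiftedL_mem hN fun j hj k hk => shiftedL_mem j k (by omega))
  have le_mul : N.toSubmodule ≤ G.toSubmodule * weylLoc.toSubmodule :=
    toSubmodule_sup_le_mul_of_commute fun a ha b hb => commute_of_mem_H_of_mem_weylLoc (hG ha) hb
  rwa [sup_eq_top, Algebra.top_toSubmodule, top_le_iff] at le_mul

theorem adjoin_Y_eq_H :
    Algebra.adjoin ℂ ({Y (1, -1), Y (-1, 1), Y (1, 0), Y (0, 1)} : Set ULoc) = H := by
  have adjoin_le :
      Algebra.adjoin ℂ ({Y (1, -1), Y (-1, 1), Y (1, 0), Y (0, 1)} : Set ULoc) ≤ H := by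
    refine Algebra.adjoin_le ?_
    rintro _ (rfl | rfl | rfl | rfl)
    exacts [Y_mem_H ⟨(1, -1), by decide⟩, Y_mem_H ⟨(-1, 1), by decide⟩,
      Y_mem_H ⟨(1, 0), by decide⟩, Y_mem_H ⟨(0, 1), by decide⟩]
  refine le_antisymm adjoin_le (Subalgebra.toSubmodule.le_iff_le.1 (toSubmodule_H_le adjoin_le ?_))
  exact toSubmodule_mul_weylLoc_eq_top adjoin_le (Algebra.subset_adjoin (by simp))
    (Algebra.subset_adjoin (by simp)) (Algebra.subset_adjoin (by simp))

theorem yFiltration_le [LinearOrder YIndex] (n : ℕ) :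
    yFiltration n ≤ Submodule.span ℂ (Set.range orderedMonomial) * weylLoc.toSubmodule :=
  wordFiltration_le_of_sorted commute_Y_of_mem_weylLoc Y_mul_sub_mul_mem_yFiltration
    (N := fun _ => Submodule.span ℂ (Set.range orderedMonomial) * weylLoc.toSubmodule)
    monotone_const (fun s c hc => ⟨_, Submodule.mul_mem_mul (Submodule.subset_span ⟨s, rfl⟩) hc, by
      rw [orderedMonomial, sub_self]; exact zero_mem _⟩) n

theorem toSubmodule_adjoin_range_Y_le [LinearOrder YIndex] :
    (Algebra.adjoin ℂ (Set.range fun α : YIndex => Y α.1)).toSubmodule ≤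
      Submodule.span ℂ (Set.range orderedMonomial) * weylLoc.toSubmodule := by
  have words_le : Submodule.span ℂ (Set.range fun l : List YIndex => (l.map fun α => Y α.1).prod) ≤
      Submodule.span ℂ (Set.range orderedMonomial) * weylLoc.toSubmodule :=
    Submodule.span_le.2 <| Set.range_subset_iff.2 fun l => yFiltration_le _
      (prod_mem_wordFiltration (Nat.lt_succ_self (l.map YIndex.deg).sum))
  have one_mem : (1 : ULoc) ∈ Submodule.span ℂ
      (Set.range fun l : List YIndex => (l.map fun α => Y α.1).prod) :=
    Submodule.subset_span ⟨[], List.prod_nil⟩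
  refine (toSubmodule_adjoin_le_span_range one_mem ?_).trans words_le
  rintro l _ ⟨α, rfl⟩
  exact Submodule.subset_span ⟨l ++ [α], by simp⟩

theorem span_orderedMonomial [LinearOrder YIndex] :
    Submodule.span ℂ (Set.range orderedMonomial) = H.toSubmodule := by
  set V := Submodule.span ℂ (Set.range orderedMonomial)
  set G := Algebra.adjoin ℂ (Set.range fun α : YIndex => Y α.1)
  have V_le : V ≤ H.toSubmodule := Submodule.span_le.2 <| Set.range_subset_iff.2 fun s =>
    H.list_prod_mem (List.forall_mem_map.2 fun α _ => Y_mem_H α)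
  have Y_mem (α : YIndex) : Y α.1 ∈ G := Algebra.subset_adjoin ⟨α, rfl⟩
  have mul_eq_top : G.toSubmodule * weylLoc.toSubmodule = ⊤ :=
    toSubmodule_mul_weylLoc_eq_top (Algebra.adjoin_le (Set.range_subset_iff.2 Y_mem_H))
      (Y_mem ⟨(1, -1), by decide⟩) (Y_mem ⟨(-1, 1), by decide⟩) (Y_mem ⟨(1, 0), by decide⟩)
  refine le_antisymm V_le (toSubmodule_H_le V_le (top_le_iff.1 ?_))
  rw [← mul_eq_top]
  refine (mul_le_mul_left toSubmodule_adjoin_range_Y_le _).trans_eq ?_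
  rw [mul_assoc, weylLoc.isIdempotentElem_toSubmodule.eq]

end Generation

section Kernel

theorem mul_pow_eq_zero_of_mul_eq_zero {R : Type*} [Ring R] {x : R} {n : ℕ} {r : R}
    (h : (fun v : R => x * v - v * x)^[n] r = 0) (h0 : x * r = 0) : r * x ^ n = 0 := by
  induction n generalizing r with
  | zero => simpa using h
  | succ n ih =>
    rw [Function.iterate_succ_apply, h0, zero_sub] at h
    have := ih h (by rw [mul_neg, ← mul_assoc, h0, zero_mul, neg_zero])
    rwa [neg_mul, neg_eq_zero, mul_assoc, ← pow_succ'] at this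

theorem exists_mul_pow_eq_zero {R : Type*} [Ring R] {x : R}
    (hx : ∀ r, ∃ n : ℕ, (fun v : R => x * v - v * x)^[n] r = 0) {i : ℕ} {r : R}
    (h : x ^ i * r = 0) : ∃ n : ℕ, r * x ^ n = 0 := by
  induction i generalizing r with
  | zero => exact ⟨0, by simpa using h⟩
  | succ i ih =>
    obtain ⟨n, hn⟩ := ih (r := x * r) (by rw [← mul_assoc, ← pow_succ, h])
    obtain ⟨m, hm⟩ := hx (r * x ^ n)
    refine ⟨n + m, ?_⟩
    rw [pow_add, ← mul_assoc]
    exact mul_pow_eq_zero_of_mul_eq_zero hm (by rw [← mul_assoc, hn])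

theorem exists_mul_eq_zero_of_locHom_eq_zero {u : U} (h : locHom u = 0) :
    ∃ m n : ℕ, u * (toU (partialS 0) ^ m * toU (partialS 1) ^ n) = 0 := by
  have oreDiv_eq : OreLocalization.oreDiv (0 : U) (1 : partialMonoid) =
      OreLocalization.oreDiv u (1 : partialMonoid) := by
    rw [OreLocalization.zero_oreDiv]
    exact h.symm
  rw [OreLocalization.oreDiv_eq_iff] at oreDiv_eq
  obtain ⟨⟨_, i, j, rfl⟩, v, smul_eq, -⟩ := oreDiv_eq
  have mul_eq_zero : toU (partialS 0) ^ i * (toU (partialS 1) ^ j * u) = 0 := by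
    rw [smul_zero] at smul_eq
    rw [← mul_assoc]
    exact smul_eq
  obtain ⟨m, hm⟩ := exists_mul_pow_eq_zero (commutator_nilpotent 0) mul_eq_zero
  rw [mul_assoc] at hm
  obtain ⟨n, hn⟩ := exists_mul_pow_eq_zero (commutator_nilpotent 1) hm
  exact ⟨m, n, by rw [← mul_assoc, hn]⟩

end Kernel

section Representation

/-- The labels of the basis `L_α`, `dᵢ`, `∂ᵢ` of `S̄₂`. -/
inductive GenIndex : Type
  | hamS (α : YIndex)
  | eulerS (i : Fin 2)
  | partialS (i : Fin 2)

/-- The basis `L_α`, `dᵢ`, `∂ᵢ` of `S̄₂`. -/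
def gen : GenIndex → SBar
  | .hamS α => hamS (tPow α.fst α.snd)
  | .eulerS i => eulerS i
  | .partialS i => partialS i

section

attribute [local instance] LieRing.ofAssociativeRing

/-- The tautological representation of `S̄₂` on the space of polynomials. -/
def polyRep : SBar →ₗ⁅ℂ⁆ Module.End ℂ A2 where
  toFun D := ((D : W2) : A2 →ₗ[ℂ] A2)
  map_add' _ _ := rfl
  map_smul' _ _ := rfl
  map_lie' := rfl

end

/-- The linear form on endomorphisms of the space of polynomials which sends a derivation to the
coefficient of `t^s` in its component along `∂ᵥ`, and the identity to `0`. -/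
def coeffForm (v : Fin 2) (s : Fin 2 →₀ ℕ) : Module.End ℂ A2 →ₗ[ℂ] ℂ :=
  lcoeff ℂ s ∘ₗ LinearMap.applyₗ (X v : A2) -
    coeff s (X v : A2) • (lcoeff ℂ 0 ∘ₗ LinearMap.applyₗ (1 : A2))

theorem coeffForm_one (v : Fin 2) (s : Fin 2 →₀ ℕ) : coeffForm v s 1 = 0 := by
  simp [coeffForm]

theorem coeffForm_polyRep (v : Fin 2) (s : Fin 2 →₀ ℕ) (D : SBar) :
    coeffForm v s (polyRep D) = coeff s ((D : W2) (X v)) := by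
  have apply_one : polyRep D (1 : A2) = 0 := (D : W2).map_one_eq_zero
  have apply_X : polyRep D (X v : A2) = (D : W2) (X v) := rfl
  simp [coeffForm, apply_one, apply_X]

theorem coeff_tPow (s : Fin 2 →₀ ℕ) (j k : ℕ) :
    coeff s (tPow j k) = if j = s 0 ∧ k = s 1 then 1 else 0 := by
  have tPow_eq : tPow j k = monomial (Finsupp.single 0 j + Finsupp.single 1 k) 1 := by
    rw [monomial_eq_smul_tPow, one_smul]
    simp
  rw [tPow_eq, coeff_monomial]
  refine if_congr ⟨?_, fun ⟨hj, hk⟩ => ?_⟩ rfl rfl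
  · rintro rfl
    simp
  · ext i
    fin_cases i <;> simp [hj, hk]

theorem coeffForm_zero_polyRep_hamS (s : Fin 2 →₀ ℕ) (j k : ℕ) :
    coeffForm 0 s (polyRep (hamS (tPow j k))) =
      if j = s 0 ∧ k = s 1 + 1 then (k : ℂ) else 0 := by
  have apply_X : (hamS (tPow j k) : W2) (X 0) = (k : ℂ) • tPow j (k - 1) := by
    rw [← pderiv_one_tPow]
    exact hamiltonian_X_zero _
  rw [coeffForm_polyRep, apply_X, coeff_smul, coeff_tPow]
  cases k <;> simp

theorem coeffForm_one_polyRep_hamS (s : Fin 2 →₀ ℕ) (j k : ℕ) :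
    coeffForm 1 s (polyRep (hamS (tPow j k))) =
      if j = s 0 + 1 ∧ k = s 1 then -(j : ℂ) else 0 := by
  have apply_X : (hamS (tPow j k) : W2) (X 1) = -((j : ℂ) • tPow (j - 1) k) := by
    rw [← pderiv_zero_tPow]
    exact hamiltonian_X_one _
  rw [coeffForm_polyRep, apply_X, coeff_neg, coeff_smul, coeff_tPow]
  cases j <;> simp [neg_ite]

theorem coeffForm_polyRep_eulerS (v : Fin 2) (s : Fin 2 →₀ ℕ) (i : Fin 2) :
    coeffForm v s (polyRep (eulerS i)) = if i = v ∧ Finsupp.single v 1 = s then 1 else 0 := by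
  have apply_X : (eulerS i : W2) (X v) = X i * pderiv i (X v) := rfl
  rw [coeffForm_polyRep, apply_X]
  obtain rfl | h := eq_or_ne i v
  · simp [coeff_X]
  · simp [h, h.symm]

theorem coeffForm_polyRep_partialS (v : Fin 2) (s : Fin 2 →₀ ℕ) (i : Fin 2) :
    coeffForm v s (polyRep (partialS i)) = if i = v ∧ 0 = s then 1 else 0 := by
  have apply_X : (partialS i : W2) (X v) = pderiv i (X v) := rfl
  rw [coeffForm_polyRep, apply_X]
  obtain rfl | h := eq_or_ne i v
  · simp [coeff_one]
  · simp [h, h.symm]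

theorem YIndex.two_le_fst_add_snd (α : YIndex) : 2 ≤ α.fst + α.snd := by
  have := α.coe_fst_sub_one
  have := α.coe_snd_sub_one
  have := α.2.2.2.1
  omega

theorem YIndex.not_fst_eq_one_and_snd_eq_one (α : YIndex) : ¬(α.fst = 1 ∧ α.snd = 1) := by
  have hfst := α.coe_fst_sub_one
  have hsnd := α.coe_snd_sub_one
  rintro ⟨h1, h2⟩
  exact α.2.2.2.2 (Prod.ext (by rw [← hfst, h1]; rfl) (by rw [← hsnd, h2]; rfl))

/-- The linear forms dual to the basis `gen` of `S̄₂`. -/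
def dualForm : GenIndex → Module.End ℂ A2 →ₗ[ℂ] ℂ
  | .hamS α =>
    if α.snd = 0 then (-(α.fst : ℂ)⁻¹) • coeffForm 1 (Finsupp.single 0 (α.fst - 1))
    else (α.snd : ℂ)⁻¹ • coeffForm 0 (Finsupp.single 0 α.fst + Finsupp.single 1 (α.snd - 1))
  | .eulerS i => coeffForm i (Finsupp.single i 1)
  | .partialS i => coeffForm i 0

theorem dualForm_one (x : GenIndex) : dualForm x 1 = 0 := by
  cases x with
  | hamS α => rw [dualForm]; split_ifs <;> rw [LinearMap.smul_apply, coeffForm_one, smul_zero]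
  | eulerS i => exact coeffForm_one i _
  | partialS i => exact coeffForm_one i _

theorem dualForm_hamS_of_snd_eq_zero [DecidableEq GenIndex] {α : YIndex} (h : α.snd = 0)
    (x : GenIndex) :
    dualForm (.hamS α) (polyRep (gen x)) = if .hamS α = x then 1 else 0 := by
  have hα := α.two_le_fst_add_snd
  rw [dualForm, if_pos h, LinearMap.smul_apply]
  cases x with
  | hamS β =>
    have index_iff : β.fst = α.fst - 1 + 1 ∧ β.snd = 0 ↔ GenIndex.hamS α = .hamS β := by
      rw [GenIndex.hamS.injEq]
      refine ⟨fun hβ => YIndex.ext_fst_snd (by omega) (by omega), ?_⟩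
      rintro rfl
      omega
    have fst_ne_zero : (α.fst : ℂ) ≠ 0 := Nat.cast_ne_zero.2 (by omega)
    rw [gen, coeffForm_one_polyRep_hamS]
    simp only [Finsupp.single_eq_same, ne_eq, one_ne_zero, not_false_eq_true,
      Finsupp.single_eq_of_ne, index_iff]
    split_ifs with hαβ
    · obtain rfl := GenIndex.hamS.inj hαβ
      simp [fst_ne_zero]
    · simp
  | eulerS i =>
    rw [gen, coeffForm_polyRep_eulerS, if_neg, if_neg (by simp), smul_zero]
    exact fun hs => by simpa using DFunLike.congr_fun hs.2 1
  | partialS i =>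
    rw [gen, coeffForm_polyRep_partialS, if_neg, if_neg (by simp), smul_zero]
    rintro ⟨-, hs⟩
    have fst_eq : 0 = α.fst - 1 := by simpa using DFunLike.congr_fun hs 0
    omega

theorem dualForm_hamS_of_snd_ne_zero [DecidableEq GenIndex] {α : YIndex} (h : α.snd ≠ 0)
    (x : GenIndex) :
    dualForm (.hamS α) (polyRep (gen x)) = if .hamS α = x then 1 else 0 := by
  have hα := α.two_le_fst_add_snd
  have hα' := α.not_fst_eq_one_and_snd_eq_one
  rw [dualForm, if_neg h, LinearMap.smul_apply]
  cases x with
  | hamS β =>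
    have index_iff : β.fst = α.fst ∧ β.snd = α.snd - 1 + 1 ↔ GenIndex.hamS α = .hamS β := by
      rw [GenIndex.hamS.injEq]
      refine ⟨fun hβ => YIndex.ext_fst_snd (by omega) (by omega), ?_⟩
      rintro rfl
      omega
    have snd_ne_zero : (α.snd : ℂ) ≠ 0 := Nat.cast_ne_zero.2 h
    rw [gen, coeffForm_zero_polyRep_hamS]
    simp only [Finsupp.add_apply, Finsupp.single_eq_same, ne_eq, one_ne_zero, zero_ne_one,
      not_false_eq_true, Finsupp.single_eq_of_ne, add_zero, zero_add, index_iff]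
    split_ifs with hαβ
    · obtain rfl := GenIndex.hamS.inj hαβ
      simp [snd_ne_zero]
    · simp
  | eulerS i =>
    rw [gen, coeffForm_polyRep_eulerS, if_neg, if_neg (by simp), smul_zero]
    rintro ⟨-, hs⟩
    have fst_eq : (1 : ℕ) = α.fst := by simpa using DFunLike.congr_fun hs 0
    have snd_eq : 0 = α.snd - 1 := by simpa using DFunLike.congr_fun hs 1
    omega
  | partialS i =>
    rw [gen, coeffForm_polyRep_partialS, if_neg, if_neg (by simp), smul_zero]
    rintro ⟨-, hs⟩
    have fst_eq : 0 = α.fst := by simpa using DFunLike.congr_fun hs 0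
    have snd_eq : 0 = α.snd - 1 := by simpa using DFunLike.congr_fun hs 1
    omega

theorem dualForm_eulerS [DecidableEq GenIndex] (i : Fin 2) (x : GenIndex) :
    dualForm (.eulerS i) (polyRep (gen x)) = if .eulerS i = x then 1 else 0 := by
  rw [dualForm]
  cases x with
  | hamS β =>
    have hβ := β.not_fst_eq_one_and_snd_eq_one
    rw [gen, if_neg (by simp)]
    fin_cases i
    · exact (coeffForm_zero_polyRep_hamS _ _ _).trans (if_neg (by simpa using hβ))
    · exact (coeffForm_one_polyRep_hamS _ _ _).trans (if_neg (by simpa using hβ))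
  | eulerS j => simp [gen, coeffForm_polyRep_eulerS, eq_comm]
  | partialS j => simp [gen, coeffForm_polyRep_partialS, eq_comm]

theorem dualForm_partialS [DecidableEq GenIndex] (i : Fin 2) (x : GenIndex) :
    dualForm (.partialS i) (polyRep (gen x)) = if .partialS i = x then 1 else 0 := by
  rw [dualForm]
  cases x with
  | hamS β =>
    have hβ := β.two_le_fst_add_snd
    rw [gen, if_neg (by simp)]
    fin_cases i
    · exact (coeffForm_zero_polyRep_hamS _ _ _).trans
        (if_neg (by simp only [Finsupp.coe_zero, Pi.zero_apply]; omega))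
    · exact (coeffForm_one_polyRep_hamS _ _ _).trans
        (if_neg (by simp only [Finsupp.coe_zero, Pi.zero_apply]; omega))
  | eulerS j => simp [gen, coeffForm_polyRep_eulerS]
  | partialS j => simp [gen, coeffForm_polyRep_partialS, eq_comm]

theorem dualForm_polyRep_gen [DecidableEq GenIndex] (x y : GenIndex) :
    dualForm x (polyRep (gen y)) = if x = y then 1 else 0 := by
  cases x with
  | hamS α =>
    obtain h | h := eq_or_ne α.snd 0
    exacts [dualForm_hamS_of_snd_eq_zero h y, dualForm_hamS_of_snd_ne_zero h y]
  | eulerS i => exact dualForm_eulerS i y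
  | partialS i => exact dualForm_partialS i y

end Representation

section OrderedMonomials

variable [LinearOrder YIndex]

/-- The letters of the Poincaré–Birkhoff–Witt monomial `L^s d₁ᵃ d₂ᵇ ∂₁ᵐ ∂₂ⁿ`, for
`x = (s, (a, b), (m, n))`. -/
def pbwWord (x : Multiset YIndex × (ℕ × ℕ) × (ℕ × ℕ)) : List GenIndex :=
  x.1.sort.map .hamS ++
    (List.replicate x.2.1.1 (.eulerS 0) ++ List.replicate x.2.1.2 (.eulerS 1)) ++
    (List.replicate x.2.2.1 (.partialS 0) ++ List.replicate x.2.2.2 (.partialS 1))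

theorem eq_of_pbwWord_perm {x y : Multiset YIndex × (ℕ × ℕ) × (ℕ × ℕ)}
    (h : (pbwWord x).Perm (pbwWord y)) : x = y := by
  classical
  have count_hamS (x : Multiset YIndex × (ℕ × ℕ) × (ℕ × ℕ)) (α : YIndex) :
      (pbwWord x).count (.hamS α) = x.1.count α := by
    simp only [pbwWord, List.count_append, List.count_replicate,
      List.count_map_of_injective _ _ (fun _ _ => GenIndex.hamS.inj)]
    simp [← Multiset.coe_count]
  have count_eulerS (x : Multiset YIndex × (ℕ × ℕ) × (ℕ × ℕ)) (i : Fin 2) :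
      (pbwWord x).count (.eulerS i) = if i = 0 then x.2.1.1 else x.2.1.2 := by
    fin_cases i <;> simp [pbwWord, List.count_replicate, List.count_eq_zero]
  have count_partialS (x : Multiset YIndex × (ℕ × ℕ) × (ℕ × ℕ)) (i : Fin 2) :
      (pbwWord x).count (.partialS i) = if i = 0 then x.2.2.1 else x.2.2.2 := by
    fin_cases i <;> simp [pbwWord, List.count_replicate, List.count_eq_zero]
  refine Prod.ext (Multiset.ext.2 fun α => ?_) (Prod.ext (Prod.ext ?_ ?_) (Prod.ext ?_ ?_))
  · rw [← count_hamS, h.count_eq, count_hamS]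
  · simpa [count_eulerS] using h.count_eq (.eulerS 0)
  · simpa [count_eulerS] using h.count_eq (.eulerS 1)
  · simpa [count_partialS] using h.count_eq (.partialS 0)
  · simpa [count_partialS] using h.count_eq (.partialS 1)

/-- The monomial `L^s d₁ᵃ d₂ᵇ ∂₁ᵐ ∂₂ⁿ` in `U(S̄₂)`, for `x = (s, (a, b), (m, n))`. -/
def pbwMonomial (x : Multiset YIndex × (ℕ × ℕ) × (ℕ × ℕ)) : U := wordProd gen (pbwWord x)

theorem pbwMonomial_eq (s : Multiset YIndex) (a b m n : ℕ) :
    pbwMonomial (s, (a, b), (m, n)) = (s.sort.map fun α => toU (hamS (tPow α.fst α.snd))).prod *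
      (toU (eulerS 0) ^ a * toU (eulerS 1) ^ b) *
        (toU (partialS 0) ^ m * toU (partialS 1) ^ n) := by
  simp only [pbwMonomial, pbwWord, wordProd, List.map_append, List.prod_append,
    List.map_replicate, List.prod_replicate, List.map_map]
  rfl

theorem pbwMonomial_mul (s : Multiset YIndex) (a b m n k l : ℕ) :
    pbwMonomial (s, (a, b), (m, n)) * (toU (partialS 0) ^ k * toU (partialS 1) ^ l) =
      pbwMonomial (s, (a, b), (m + k, n + l)) := by
  have commute : Commute (toU (partialS 1) ^ n) (toU (partialS 0) ^ k) :=
    Commute.pow_pow (toU_partial_comm 1 0) n k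
  rw [pbwMonomial_eq, pbwMonomial_eq, mul_assoc, commute.mul_mul_mul_comm, pow_add, pow_add]

theorem linearIndependent_pbwMonomial : LinearIndependent ℂ pbwMonomial := by
  classical
  exact linearIndependent_wordProd polyRep gen dualForm dualForm_one dualForm_polyRep_gen pbwWord
    fun _ _ => eq_of_pbwWord_perm

theorem linearIndependent_locHom_pbwMonomial :
    LinearIndependent ℂ fun x => locHom (pbwMonomial x) := by
  rw [linearIndependent_iff]
  intro g hg
  have locHom_eq_zero : locHom (Finsupp.linearCombination ℂ pbwMonomial g) = 0 := by
    rw [← AlgHom.toLinearMap_apply, Finsupp.apply_linearCombination]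
    exact hg
  obtain ⟨k, l, hkl⟩ := exists_mul_eq_zero_of_locHom_eq_zero locHom_eq_zero
  set shift : Multiset YIndex × (ℕ × ℕ) × (ℕ × ℕ) → Multiset YIndex × (ℕ × ℕ) × (ℕ × ℕ) :=
    fun x => (x.1, x.2.1, (x.2.2.1 + k, x.2.2.2 + l))
  have shift_injective : Function.Injective shift := by
    rintro ⟨s, ab, m, n⟩ ⟨s', ab', m', n'⟩ h
    simpa [shift] using h
  refine linearIndependent_iff.1 (linearIndependent_pbwMonomial.comp shift shift_injective) g ?_
  have pbwMonomial_shift : pbwMonomial ∘ shift = LinearMap.mulRight ℂ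
      (toU (partialS 0) ^ k * toU (partialS 1) ^ l) ∘ pbwMonomial :=
    _root_.funext fun x => (pbwMonomial_mul _ _ _ _ _ _ _).symm
  rw [pbwMonomial_shift, ← Finsupp.apply_linearCombination, LinearMap.mulRight_apply, hkl]

/-- The monomial `d₁ᵃ d₂ᵇ ∂^β` in `U₍₋₁₎`, for `x = ((a, b), β)`. -/
def weylMonomial (x : (ℕ × ℕ) × (ℤ × ℤ)) : ULoc := dLoc 0 ^ x.1.1 * dLoc 1 ^ x.1.2 * partialPow x.2

/-- The monomial `L^s d₁ᵃ d₂ᵇ ∂^β` in `U₍₋₁₎`, for `x = (s, (a, b), β)`. -/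
def locMonomial (x : Multiset YIndex × (ℕ × ℕ) × (ℤ × ℤ)) : ULoc :=
  (x.1.sort.map fun α => locL α.fst α.snd).prod * weylMonomial x.2

theorem locHom_pbwMonomial (s : Multiset YIndex) (a b m n : ℕ) :
    locHom (pbwMonomial (s, (a, b), (m, n))) = locMonomial (s, (a, b), (m, n)) := by
  rw [pbwMonomial_eq, locMonomial, weylMonomial, partialPow_natCast, map_mul, map_mul, map_mul,
    map_mul, map_pow, map_pow, map_pow, map_pow, map_list_prod, List.map_map, mul_assoc]
  rfl

theorem locMonomial_mul_partialPow (s : Multiset YIndex) (ab : ℕ × ℕ) (β γ : ℤ × ℤ) :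
    locMonomial (s, ab, β) * partialPow γ = locMonomial (s, ab, β + γ) := by
  simp only [locMonomial, weylMonomial, partialPow_add, mul_assoc]

theorem linearIndependent_locMonomial : LinearIndependent ℂ locMonomial := by
  rw [linearIndependent_iff_finset_linearIndependent]
  intro t
  obtain ⟨N, hN⟩ : ∃ N : ℕ, ∀ x ∈ t, 0 ≤ x.2.2.1 + N ∧ 0 ≤ x.2.2.2 + N := by
    refine ⟨t.sup fun x => x.2.2.1.natAbs + x.2.2.2.natAbs, fun x hx => ?_⟩
    have := Finset.le_sup (f := fun x => x.2.2.1.natAbs + x.2.2.2.natAbs) hx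
    omega
  set shift : t → Multiset YIndex × (ℕ × ℕ) × (ℕ × ℕ) :=
    fun x => (x.1.1, x.1.2.1, ((x.1.2.2.1 + N).toNat, (x.1.2.2.2 + N).toNat))
  have shift_injective : Function.Injective shift := by
    rintro ⟨⟨s, ab, m, n⟩, hx⟩ ⟨⟨s', ab', m', n'⟩, hy⟩ h
    have hx := hN _ hx
    have hy := hN _ hy
    simp only [shift, Prod.mk.injEq] at h hx hy
    obtain ⟨rfl, rfl, hm, hn⟩ := h
    obtain rfl : m = m' := by omega
    obtain rfl : n = n' := by omega
    rfl
  refine LinearIndependent.of_comp (LinearMap.mulRight ℂ (partialPow (N, N))) ?_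
  have locMonomial_shift (x : t) :
      locMonomial x.1 * partialPow (N, N) = locHom (pbwMonomial (shift x)) := by
    obtain ⟨⟨s, ab, m, n⟩, hx⟩ := x
    have hx := hN _ hx
    rw [locMonomial_mul_partialPow, locHom_pbwMonomial, Int.toNat_of_nonneg hx.1,
      Int.toNat_of_nonneg hx.2]
    rfl
  have comp_eq : LinearMap.mulRight ℂ (partialPow (N, N)) ∘ (fun x : t => locMonomial x.1) =
      (fun x => locHom (pbwMonomial x)) ∘ shift := _root_.funext locMonomial_shift
  exact comp_eq ▸ linearIndependent_locHom_pbwMonomial.comp shift shift_injective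

end OrderedMonomials

section Independence

theorem toSubmodule_weylLoc_le_span :
    weylLoc.toSubmodule ≤ Submodule.span ℂ (Set.range weylMonomial) := by
  refine toSubmodule_weylLoc_le_mul.trans ((mul_le_mul'
    (localizedWeyl_le_span_pow (semiconjBy_partialUnit_dLoc 0))
    (localizedWeyl_le_span_pow (semiconjBy_partialUnit_dLoc 1))).trans ?_)
  rw [Submodule.span_mul_span]
  refine Submodule.span_mono ?_
  rintro _ ⟨_, ⟨⟨a, m⟩, rfl⟩, _, ⟨⟨b, n⟩, rfl⟩, rfl⟩
  have commute : Commute ((partialUnit 0 ^ m : ULocˣ) : ULoc) (dLoc 1 ^ b) :=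
    (commute_partialUnit_dLoc zero_ne_one).units_zpow_left m |>.pow_right b
  refine ⟨((a, b), (m, n)), ?_⟩
  rw [weylMonomial, partialPow, Units.val_mul]
  exact commute.symm.mul_mul_mul_comm _ _

theorem prod_map_partialPow (l : List YIndex) :
    (l.map fun α => partialPow α.1).prod = partialPow (l.map fun α => (α.1 : ℤ × ℤ)).sum := by
  induction l with
  | nil => exact partialPow_zero.symm
  | cons α l ih => rw [List.map_cons, List.prod_cons, ih, List.map_cons, List.sum_cons,
      partialPow_add]

theorem prod_sub_prod_mul_partialPow_mem_yFiltration (l : List YIndex) :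
    (l.map fun α => Y α.1).prod -
        (l.map fun α => locL α.fst α.snd).prod * partialPow (l.map fun α => (α.1 : ℤ × ℤ)).sum ∈
      yFiltration (l.map YIndex.deg).sum := by
  rw [← prod_map_partialPow]
  exact prod_sub_prod_mul_prod_mem_wordFiltration commute_Y_of_mem_weylLoc
    locL_fst_snd_mem_yFiltration (fun _ => partialPow_mem_weylLoc _)
    (fun α β => by rw [Commute, SemiconjBy, ← partialPow_add, ← partialPow_add, add_comm])
    Y_sub_locL_mul_partialPow_mem_yFiltration l

theorem sum_map_deg_sort [LinearOrder YIndex] (s : Multiset YIndex) :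
    (s.sort.map YIndex.deg).sum = (s.map YIndex.deg).sum := by
  rw [← Multiset.sum_coe, ← Multiset.map_coe, Multiset.sort_eq]

/-- The index of the leading term of the ordered monomial of `s`. -/
def leadingIndex [LinearOrder YIndex] (s : Multiset YIndex) :
    Multiset YIndex × (ℕ × ℕ) × (ℤ × ℤ) :=
  (s, (0, 0), (s.sort.map fun α => (α.1 : ℤ × ℤ)).sum)

theorem locMonomial_leadingIndex [LinearOrder YIndex] (s : Multiset YIndex) :
    locMonomial (leadingIndex s) = (s.sort.map fun α => locL α.fst α.snd).prod *
      partialPow (s.sort.map fun α => (α.1 : ℤ × ℤ)).sum := by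
  simp only [locMonomial, leadingIndex, weylMonomial, pow_zero, one_mul]

theorem orderedMonomial_sub_locMonomial_mem_yFiltration [LinearOrder YIndex]
    (s : Multiset YIndex) :
    orderedMonomial s - locMonomial (leadingIndex s) ∈ yFiltration (s.map YIndex.deg).sum := by
  have h := prod_sub_prod_mul_partialPow_mem_yFiltration s.sort
  rw [sum_map_deg_sort, ← locMonomial_leadingIndex] at h
  exact h

theorem locMonomial_mul_mem_span [LinearOrder YIndex] (s : Multiset YIndex) {c : ULoc}
    (hc : c ∈ weylLoc) : locMonomial (leadingIndex s) * c ∈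
      Submodule.span ℂ (locMonomial '' {x | x.1 = s}) := by
  have span_le : Submodule.span ℂ (Set.range weylMonomial) ≤
      (Submodule.span ℂ (locMonomial '' {x | x.1 = s})).comap
        (LinearMap.mulLeft ℂ (s.sort.map fun α => locL α.fst α.snd).prod) :=
    Submodule.span_le.2 <| Set.range_subset_iff.2 fun x => Submodule.subset_span ⟨(s, x), rfl, rfl⟩
  rw [locMonomial_leadingIndex, mul_assoc]
  exact span_le (toSubmodule_weylLoc_le_span (weylLoc.mul_mem (partialPow_mem_weylLoc _) hc))

theorem yFiltration_le_span_locMonomial [LinearOrder YIndex] (n : ℕ) :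
    yFiltration n ≤ Submodule.span ℂ (locMonomial '' {x | (x.1.map YIndex.deg).sum < n}) := by
  refine wordFiltration_le_of_sorted commute_Y_of_mem_weylLoc Y_mul_sub_mul_mem_yFiltration
    (N := fun n => Submodule.span ℂ (locMonomial '' {x | (x.1.map YIndex.deg).sum < n}))
    (fun _ _ h => Submodule.span_mono (Set.image_mono fun _ hx => lt_of_lt_of_le hx h))
    (fun s c hc => ?_) n
  refine ⟨locMonomial (leadingIndex s) * c,
    Submodule.span_mono (Set.image_mono ?_) (locMonomial_mul_mem_span s hc), ?_⟩
  · rintro x rfl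
    exact Nat.lt_succ_self _
  · have lower := mul_mem_yFiltration_of_mem_weylLoc
      (orderedMonomial_sub_locMonomial_mem_yFiltration s) hc
    rwa [sub_mul] at lower

theorem linearIndependent_orderedMonomial [LinearOrder YIndex] :
    LinearIndependent ℂ orderedMonomial :=
  linearIndependent_of_sub_mem_span linearIndependent_locMonomial
    (fun x => (x.1.map YIndex.deg).sum) (e := leadingIndex) (fun _ _ h => congrArg Prod.fst h)
    fun s => yFiltration_le_span_locMonomial _ (orderedMonomial_sub_locMonomial_mem_yFiltration s)

end Independence

end SBarTwo

end

theorem corollary5 [LinearOrder SBarTwo.YIndex] :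
    (∃ b : Module.Basis (Multiset SBarTwo.YIndex) ℂ SBarTwo.H,
      ∀ s : Multiset SBarTwo.YIndex, (b s : SBarTwo.ULoc) = SBarTwo.orderedMonomial s) ∧
    Algebra.adjoin ℂ
      ({SBarTwo.Y (1, -1), SBarTwo.Y (-1, 1), SBarTwo.Y (1, 0), SBarTwo.Y (0, 1)} :
        Set SBarTwo.ULoc) = SBarTwo.H := by
  refine ⟨⟨(Module.Basis.span SBarTwo.linearIndependent_orderedMonomial).map
    (LinearEquiv.ofEq _ _ SBarTwo.span_orderedMonomial), fun s => ?_⟩, SBarTwo.adjoin_Y_eq_H⟩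
  rw [Module.Basis.map_apply, LinearEquiv.coe_ofEq_apply, Module.Basis.span_apply]
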